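/- Let $\langle x\rangle=(1+x^2)^{1/2}$ and let $\widehat H^1=\{u\in H^1(\mathbb R;\mathbb C):\langle x\rangle u\in L^2(\mathbb R)\}$ with norm $\|u\|_{\widehat H^1}^2=\|u\|_{L^2}^2+\|\partial_xu\|_{L^2}^2+\|\langle x\rangle u\|_{L^2}^2$. Let $\widehat H^{-1}$ be the topological dual of $\widehat H^1$, with the embedding $\widehat H^1\subset\widehat H^{-1}$ given by $u\mapsto(\varphi\mapsto\int_{\mathbb R}u\varphi\,dx)$. Fix an integer $p\ge1$ and a sign $\sigma\in\{1,-1\}$. For a real-valued potential $V$ and $u^{(0)}\in\widehat H^1$ consider $$\text{(NLS)}\qquad i\partial_tu=-\partial_{xx}u+x^2u+Vu+\sigma|u|^{2p}u,\qquad u|_{t=0}=u^{(0)},$$ the equation being understood as an identity in $\widehat H^{-1}$ for every $t\in\mathbb R$, and put $$H_V(u)=\frac12\int_{\mathbb R}\bigl(|\partial_xu|^2+x^2|u|^2+V|u|^2\bigr)dx+\frac{\sigma}{2p+2}\int_{\mathbb R}|u|^{2p+2}dx .$$ **Theorem (global well-posedness).** For every $\rho>0$ there are constants $\varepsilon_\rho>0$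 and $C_\rho>0$ (depending only on $\rho$, $p$, $\sigma$) such that: 1. for every real-valued measurable $V$ with $\|V\|_{L^\infty}\le\rho$ and every $u\in\widehat H^1$ with $\|u\|_{\widehat H^1}\le C_\rho\varepsilon_\rho$, $$C_\rho^{-1}\|u\|_{\widehat H^1}^2\le H_V(u)+\rho\|u\|_{L^2}^2\le C_\rho\|u\|_{\widehat H^1}^2;$$ 2. for every real-valued $V\in\widehat H^1$ with $\|V\|_{\widehat H^1}\le\rho$ and every $u^{(0)}\in\widehat H^1$ with $\varepsilon:=\|u^{(0)}\|_{\widehat H^1}\le\varepsilon_\rho$, (NLS) has a unique global solution $u\in C_b^0(\mathbb R,\widehat H^1)\cap C^1(\mathbb R,\widehat H^{-1})$, and this solution satisfies $\|u(t)\|_{\widehat H^1}\le C_\rho\,\varepsilon$ for all $t\in\mathbb R$. -/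

import Mathlib

open MeasureTheory
open scoped ContDiff BoundedContinuousFunction

noncomputable section

namespace HarmonicNLS

/-- The complex Hilbert space `L²(ℝ) = L²(ℝ; ℂ)`. -/
abbrev L2 : Type := Lp ℂ 2 (volume : Measure ℝ)

/-- The Japanese bracket `⟨x⟩ = (1 + x²)^{1/2}`. -/
def bracket (x : ℝ) : ℝ := Real.sqrt (1 + x ^ 2)

/-- `v` is the weak derivative of `u`: `∫ φ' u = - ∫ φ v` for every real test function
`φ ∈ C_c^∞(ℝ)`. -/
def HasWeakDeriv (u v : L2) : Prop :=
  ∀ φ : ℝ → ℝ, ContDiff ℝ ∞ φ → HasCompactSupport φ →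
    ∫ x, deriv φ x • u x = -∫ x, φ x • v x

theorem integrable_test_smul {φ : ℝ → ℝ} (hφ : Continuous φ) (hc : HasCompactSupport φ)
    (u : L2) : Integrable fun x => φ x • u x := by
  have hu : LocallyIntegrable (u : ℝ → ℂ) volume :=
    (Lp.memLp u).locallyIntegrable (by norm_num)
  exact hu.integrable_smul_left_of_hasCompactSupport hφ hc

theorem HasWeakDeriv.zero : HasWeakDeriv 0 0 := by
  intro φ _ _
  have h : ∀ ψ : ℝ → ℝ, ∫ x, ψ x • (0 : L2) x = 0 := by
    intro ψ
    rw [integral_congr_ae (g := fun _ => (0 : ℂ)), integral_zero]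
    filter_upwards with x
    simp
  rw [h, h, neg_zero]

theorem HasWeakDeriv.add {u₁ v₁ u₂ v₂ : L2} (h₁ : HasWeakDeriv u₁ v₁)
    (h₂ : HasWeakDeriv u₂ v₂) : HasWeakDeriv (u₁ + u₂) (v₁ + v₂) := by
  intro φ hφ hc
  have h : ∀ ψ : ℝ → ℝ, Continuous ψ → HasCompactSupport ψ → ∀ a b : L2,
      ∫ x, ψ x • (a + b) x = (∫ x, ψ x • a x) + ∫ x, ψ x • b x := by
    intro ψ hψ hcψ a b
    rw [← integral_add (integrable_test_smul hψ hcψ a) (integrable_test_smul hψ hcψ b)]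
    refine integral_congr_ae ?_
    filter_upwards [Lp.coeFn_add a b] with x hx
    rw [hx, Pi.add_apply, smul_add]
  rw [h _ (hφ.continuous_deriv (by simp)) hc.deriv, h _ hφ.continuous hc, h₁ φ hφ hc,
    h₂ φ hφ hc, neg_add]

theorem HasWeakDeriv.smul (c : ℂ) {u v : L2} (h₁ : HasWeakDeriv u v) :
    HasWeakDeriv (c • u) (c • v) := by
  intro φ hφ hc
  have h : ∀ (ψ : ℝ → ℝ) (a : L2), ∫ x, ψ x • (c • a) x = c * ∫ x, ψ x • a x := by
    intro ψ a
    rw [← integral_const_mul]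
    refine integral_congr_ae ?_
    filter_upwards [Lp.coeFn_smul c a] with x hx
    rw [hx, Pi.smul_apply, smul_comm, smul_eq_mul]
  rw [h, h, h₁ φ hφ hc, mul_neg]

/-- The space `Ĥ¹ = {u ∈ H¹(ℝ) : ⟨x⟩ u ∈ L²(ℝ)}`. An element is stored together with its weak
derivative and its weighted version, as the triple `(u, u', ⟨x⟩ u)` in `L² × L² × L²` (both are
determined by `u`). The norm inherited from the Hilbert sum is the norm of `Ĥ¹`:
`‖u‖² = ‖u‖²_{L²} + ‖u'‖²_{L²} + ‖⟨x⟩ u‖²_{L²} = ‖u‖²_{H¹} + ‖⟨x⟩ u‖²_{L²}`. -/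
def Hhat1 : Submodule ℂ (PiLp 2 fun _ : Fin 3 => L2) where
  carrier := {w | HasWeakDeriv (w 0) (w 1) ∧ ∀ᵐ x : ℝ, w 2 x = (bracket x : ℂ) * w 0 x}
  zero_mem' := by
    refine ⟨HasWeakDeriv.zero, ?_⟩
    filter_upwards with x
    simp
  add_mem' := by
    rintro a b ⟨ha, ha'⟩ ⟨hb, hb'⟩
    refine ⟨ha.add hb, ?_⟩
    filter_upwards [ha', hb', Lp.coeFn_add (a 0) (b 0), Lp.coeFn_add (a 2) (b 2)]
      with x h₁ h₂ h₃ h₄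
    rw [PiLp.add_apply, PiLp.add_apply, h₃, h₄, Pi.add_apply, Pi.add_apply, h₁, h₂, mul_add]
  smul_mem' := by
    rintro c a ⟨ha, ha'⟩
    refine ⟨ha.smul c, ?_⟩
    filter_upwards [ha', Lp.coeFn_smul c (a 0), Lp.coeFn_smul c (a 2)] with x h₁ h₂ h₃
    rw [PiLp.smul_apply, PiLp.smul_apply, h₂, h₃, Pi.smul_apply, Pi.smul_apply, h₁,
      smul_eq_mul, smul_eq_mul, mul_left_comm]

/-- The underlying function: the continuous linear inclusion `Ĥ¹ ⊂ L²`. -/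
def fn : Hhat1 →L[ℂ] L2 :=
  (PiLp.proj 2 (fun _ : Fin 3 => L2) (0 : Fin 3)).comp Hhat1.subtypeL

/-- The weak derivative `u ↦ ∂ₓu`, from `Ĥ¹` to `L²`. -/
def dx : Hhat1 →L[ℂ] L2 :=
  (PiLp.proj 2 (fun _ : Fin 3 => L2) (1 : Fin 3)).comp Hhat1.subtypeL

/-- The space `Ĥ⁻¹`, the topological dual of `Ĥ¹`, with the dual norm. -/
abbrev HhatNeg1 : Type := StrongDual ℂ Hhat1

/-- The inclusion `Ĥ¹ ⊂ Ĥ⁻¹` (with `L²` as pivot space): the function `u` is identified with the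
functional `φ ↦ ∫ u φ dx`. -/
def toHhatNeg1 : Hhat1 →L[ℂ] HhatNeg1 :=
  ((ContinuousLinearMap.mul ℂ ℂ).lpPairing (volume : Measure ℝ) 2 2).bilinearComp fn fn

theorem toHhatNeg1_apply (u φ : Hhat1) : toHhatNeg1 u φ = ∫ x, fn u x * fn φ x :=
  ContinuousLinearMap.lpPairing_eq_integral _ _ _

theorem norm_sq_Hhat1 (u : Hhat1) :
    ‖u‖ ^ 2 = (∫ x, ‖fn u x‖ ^ 2) + (∫ x, ‖dx u x‖ ^ 2) +
      ∫ x, ‖(bracket x : ℂ) * fn u x‖ ^ 2 := by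
  have key : ∀ f : L2, ‖f‖ ^ 2 = ∫ x, ‖f x‖ ^ 2 := by
    intro f
    have h2 : (inner ℂ f f : ℂ) = ((‖f‖ ^ 2 : ℝ) : ℂ) := by
      rw [inner_self_eq_norm_sq_to_K]; norm_cast
    rw [L2.inner_def] at h2
    have h3 : (∫ x, (inner ℂ (f x) (f x) : ℂ)) = ((∫ x, ‖f x‖ ^ 2 : ℝ) : ℂ) := by
      rw [← integral_complex_ofReal]
      refine integral_congr_ae (Filter.Eventually.of_forall fun x => ?_)
      simp only [inner_self_eq_norm_sq_to_K]
      norm_cast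
    rw [h3] at h2
    exact_mod_cast h2.symm
  have h0 : ‖u‖ ^ 2 = ‖u.1 0‖ ^ 2 + ‖u.1 1‖ ^ 2 + ‖u.1 2‖ ^ 2 := by
    change ‖u.1‖ ^ 2 = _
    rw [PiLp.norm_sq_eq_of_L2, Fin.sum_univ_three]
  rw [h0, key, key, key]
  congr 1
  refine integral_congr_ae ?_
  filter_upwards [u.2.2] with x hx
  rw [hx]; rfl

/-- The Hamiltonian
`H(u) = ½ ∫ (|∂ₓu|² + x²|u|² + V|u|²) dx + σ/(2p+2) ∫ |u|^{2p+2} dx`, `σ = ±1`. -/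
def energy (p : ℕ) (σ : ℝ) (V : ℝ → ℝ) (u : Hhat1) : ℝ :=
  1 / 2 * (∫ x, (‖dx u x‖ ^ 2 + x ^ 2 * ‖fn u x‖ ^ 2 + V x * ‖fn u x‖ ^ 2)) +
    σ / (2 * p + 2) * ∫ x, ‖fn u x‖ ^ (2 * p + 2)

/-- `u ∈ C_b⁰(ℝ, Ĥ¹) ∩ C¹(ℝ, Ĥ⁻¹)` is a global solution of
`i ∂ₜu = -∂ₓₓu + x²u + Vu + σ|u|^{2p}u`, `u(0) = u₀`. The equation is an identity in `Ĥ⁻¹` for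
every `t`, that is, it holds when tested against every `φ ∈ Ĥ¹`, with
`⟨-∂ₓₓu, φ⟩ = ∫ ∂ₓu ∂ₓφ dx`. For `u, φ ∈ Ĥ¹` (hence bounded) and bounded `V` all integrals converge
absolutely. -/
structure IsGlobalSolution (p : ℕ) (σ : ℝ) (V : ℝ → ℝ) (u₀ : Hhat1) (u : ℝ →ᵇ Hhat1) :
    Prop where
  initial : u 0 = u₀
  contDiff : ContDiff ℝ 1 fun t => toHhatNeg1 (u t)
  equation : ∀ (t : ℝ) (φ : Hhat1),
    Complex.I * (deriv (fun s => toHhatNeg1 (u s)) t) φ =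
      (∫ x, dx (u t) x * dx φ x) + (∫ x : ℝ, (x : ℂ) ^ 2 * fn (u t) x * fn φ x) +
        (∫ x, (V x : ℂ) * fn (u t) x * fn φ x) +
        (σ : ℂ) * ∫ x, ((‖fn (u t) x‖ ^ (2 * p) : ℝ) : ℂ) * fn (u t) x * fn φ x

end HarmonicNLS

end

/-! The norm of `Ĥ¹` is the form norm of `T = -∂ₓₓ + x² + 2`, since `⟨x⟩² = 1 + x²` and `‖u‖²_{L²}`
is added once more. With `J = fn` the inclusion into `L²`, the bounded operator `A = gram J = J*J`
plays the role of `T⁻¹` on `Ĥ¹`, and the Riesz isomorphism turns the embedding `Ĥ¹ ⊂ Ĥ⁻¹` into `A`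
(`toHhatNeg1_eq_rieszMap`). So (NLS) is equivalent to `i (A u)' = u + A G(u)` in `Ĥ¹`, where `G(u) =
Vu - 2u + σ|u|^{2p}u` (`isGlobalSolution_iff`). On the line `Ĥ¹` embeds in `L^∞` and is an algebra,
so `G` is Lipschitz on balls of `Ĥ¹`, both for the `Ĥ¹` norm and for the `L²` norm.

The group `exp(-itT)` is obtained without unbounded operators: `z exp(-it/z)` is continuous on the
real line, so the functional calculus defines `A exp(-itA⁻¹)`, and the factor `A` is removed by
density of its range.

Existence: once `G` is truncated outside a ball, the equation for `exp(itT)u` is an ODE with bounded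
Lipschitz field, hence globally solvable (`exists_truncated_solution`). While `u` stays in the ball,
energy and mass are conserved. The curve `u` need not be differentiable in `Ĥ¹`, but `‖u‖²` is,
because the group is isometric, and the lower-order part of the energy is, because its Taylor
remainder is quadratic in `L²` (`hasDerivAt_potential`). Energy plus a multiple of mass is
comparable to `‖u‖²` near zero (`exists_coercive`), and a continuity argument keeps small data
inside the ball forever (`exists_global_of_coercive`).

Uniqueness is Grönwall's inequality for the `L²` norm of the difference of two bounded solutions
(`eq_of_hasDerivAt_gram`). -/

noncomputable section

namespace HarmonicNLS

/-! ### Primitives of locally integrable functions and weak derivatives -/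

/-- `f` is a primitive of the locally integrable function `f'`. -/
structure IsPrimitive (f f' : ℝ → ℂ) : Prop where
  locallyIntegrable : LocallyIntegrable f' volume
  sub_eq : ∀ a b, f b - f a = ∫ x in a..b, f' x

theorem locallyIntegrable_intervalIntegrable {E : Type*} [NormedAddCommGroup E] {f : ℝ → E}
    (hf : LocallyIntegrable f volume) (a b : ℝ) : IntervalIntegrable f volume a b :=
  intervalIntegrable_iff.mpr <|
    (hf.integrableOn_isCompact isCompact_uIcc).mono_set Set.uIoc_subset_uIcc

theorem absolutelyContinuous_of_sub_eq {f f' : ℝ → ℝ} (hf' : LocallyIntegrable f' volume)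
    (hf : ∀ a b, f b - f a = ∫ x in a..b, f' x) (a b : ℝ) :
    AbsolutelyContinuousOnInterval f a b := by
  have h1 := (locallyIntegrable_intervalIntegrable hf' a
    b).absolutelyContinuousOnInterval_intervalIntegral (c := a) Set.left_mem_uIcc
  have h2 : AbsolutelyContinuousOnInterval (fun _ : ℝ => f a) a b :=
    (contDiff_const (n := 1)).contDiffOn.absolutelyContinuousOnInterval
  have h3 := h2.add h1
  have h4 : f = (fun _ => f a) + fun x => ∫ v in a..x, f' v := by
    funext x
    simp [← hf]
  rw [h4]
  exact h3

theorem ae_hasDerivAt_of_sub_eq {f f' : ℝ → ℝ} (hf' : LocallyIntegrable f' volume)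
    (hf : ∀ a b, f b - f a = ∫ x in a..b, f' x) : ∀ᵐ x, HasDerivAt f (f' x) x := by
  filter_upwards [_root_.LocallyIntegrable.ae_hasDerivAt_integral hf'] with x hx
  have h := (hx 0).const_add (f 0)
  have h' : f = fun y => f 0 + ∫ t in (0 : ℝ)..y, f' t := by
    funext y
    simp [← hf]
  rw [h']
  exact h

/-- Primitives are absolutely continuous and differentiable almost everywhere, so integration by
parts for absolutely continuous functions applies. The complex product rule is assembled from this
real one. -/
theorem integral_deriv_mul_add_of_sub_eq {f f' g g' : ℝ → ℝ}
    (hf' : LocallyIntegrable f' volume) (hf : ∀ a b, f b - f a = ∫ x in a..b, f' x)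
    (hg' : LocallyIntegrable g' volume) (hg : ∀ a b, g b - g a = ∫ x in a..b, g' x) (a b : ℝ) :
    f b * g b - f a * g a = ∫ x in a..b, (f' x * g x + f x * g' x) := by
  rw [← (absolutelyContinuous_of_sub_eq hf' hf a b).integral_deriv_mul_eq_sub
    (absolutelyContinuous_of_sub_eq hg' hg a b)]
  refine intervalIntegral.integral_congr_ae ?_
  filter_upwards [ae_hasDerivAt_of_sub_eq hf' hf, ae_hasDerivAt_of_sub_eq hg' hg] with x h1 h2 _
  rw [h1.deriv, h2.deriv]

theorem continuous_of_sub_eq {E : Type*} [NormedAddCommGroup E] [NormedSpace ℝ E]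
    {f f' : ℝ → E} (hf' : LocallyIntegrable f' volume)
    (hf : ∀ a b, f b - f a = ∫ x in a..b, f' x) : Continuous f := by
  have h := (intervalIntegral.continuous_primitive
    (locallyIntegrable_intervalIntegrable hf') 0).const_add (f 0)
  convert h using 1
  funext y
  simp [← hf]

namespace IsPrimitive

variable {f f' g g' : ℝ → ℂ}

theorem continuous (hf : IsPrimitive f f') : Continuous f :=
  continuous_of_sub_eq hf.locallyIntegrable hf.sub_eq

theorem re_sub_eq (hf : IsPrimitive f f') (a b : ℝ) :
    (f b).re - (f a).re = ∫ x in a..b, (f' x).re := by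
  have h := Complex.reCLM.intervalIntegral_comp_comm
    (locallyIntegrable_intervalIntegrable hf.locallyIntegrable a b)
  simp only [Complex.reCLM_apply] at h
  rw [h, ← hf.sub_eq, Complex.sub_re]

theorem im_sub_eq (hf : IsPrimitive f f') (a b : ℝ) :
    (f b).im - (f a).im = ∫ x in a..b, (f' x).im := by
  have h := Complex.imCLM.intervalIntegral_comp_comm
    (locallyIntegrable_intervalIntegrable hf.locallyIntegrable a b)
  simp only [Complex.imCLM_apply] at h
  rw [h, ← hf.sub_eq, Complex.sub_im]

theorem locallyIntegrable_mul_continuous (hf : LocallyIntegrable f volume) (hg : Continuous g) :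
    LocallyIntegrable (fun x => f x * g x) volume := by
  rw [← locallyIntegrableOn_univ] at hf ⊢
  exact hf.mul_continuousOn hg.continuousOn isOpen_univ.isLocallyClosed

theorem locallyIntegrable_re (hf : LocallyIntegrable f volume) :
    LocallyIntegrable (fun x => (f x).re) volume := fun x => by
  obtain ⟨s, hs, h⟩ := hf x
  exact ⟨s, hs, h.re⟩

theorem locallyIntegrable_im (hf : LocallyIntegrable f volume) :
    LocallyIntegrable (fun x => (f x).im) volume := fun x => by
  obtain ⟨s, hs, h⟩ := hf x
  exact ⟨s, hs, h.im⟩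

/-- The product rule. -/
theorem mul (hf : IsPrimitive f f') (hg : IsPrimitive g g') :
    IsPrimitive (fun x => f x * g x) (fun x => f' x * g x + f x * g' x) := by
  have hl : LocallyIntegrable (fun x => f' x * g x + f x * g' x) volume := by
    refine (locallyIntegrable_mul_continuous hf.locallyIntegrable hg.continuous).add ?_
    simp only [mul_comm (f _)]
    exact locallyIntegrable_mul_continuous hg.locallyIntegrable hf.continuous
  refine ⟨hl, fun a b => ?_⟩
  have fr := locallyIntegrable_re hf.locallyIntegrable
  have fi := locallyIntegrable_im hf.locallyIntegrable
  have gr := locallyIntegrable_re hg.locallyIntegrable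
  have gi := locallyIntegrable_im hg.locallyIntegrable
  have hi := locallyIntegrable_intervalIntegrable hl a b
  have cf := hf.continuous
  have cg := hg.continuous
  have key : ∀ {p q : ℝ → ℝ}, LocallyIntegrable p volume → Continuous q →
      IntervalIntegrable (fun x => p x * q x) volume a b := fun hp hq =>
    (locallyIntegrable_intervalIntegrable hp a b).mul_continuousOn hq.continuousOn
  have key' : ∀ {p q : ℝ → ℝ}, LocallyIntegrable p volume → Continuous q →
      IntervalIntegrable (fun x => q x * p x) volume a b := fun hp hq =>
    (locallyIntegrable_intervalIntegrable hp a b).continuousOn_mul hq.continuousOn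
  have cfr : Continuous fun x => (f x).re := Complex.continuous_re.comp cf
  have cfi : Continuous fun x => (f x).im := Complex.continuous_im.comp cf
  have cgr : Continuous fun x => (g x).re := Complex.continuous_re.comp cg
  have cgi : Continuous fun x => (g x).im := Complex.continuous_im.comp cg
  apply Complex.ext
  · have h := Complex.reCLM.intervalIntegral_comp_comm hi
    simp only [Complex.reCLM_apply] at h
    rw [← h]
    have e1 := integral_deriv_mul_add_of_sub_eq fr hf.re_sub_eq gr hg.re_sub_eq a b
    have e2 := integral_deriv_mul_add_of_sub_eq fi hf.im_sub_eq gi hg.im_sub_eq a b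
    have e3 := intervalIntegral.integral_sub (μ := volume)
      ((key fr cgr).add (key' gr cfr)) ((key fi cgi).add (key' gi cfi))
    have : (f b * g b - f a * g a).re = ((f b).re * (g b).re - (f a).re * (g a).re) -
        ((f b).im * (g b).im - (f a).im * (g a).im) := by
      simp only [Complex.sub_re, Complex.mul_re]; ring
    rw [this, e1, e2]
    refine e3.symm.trans (intervalIntegral.integral_congr fun x _ => ?_)
    simp only [Complex.add_re, Complex.mul_re]; ring
  · have h := Complex.imCLM.intervalIntegral_comp_comm hi
    simp only [Complex.imCLM_apply] at h
    rw [← h]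
    have e1 := integral_deriv_mul_add_of_sub_eq fr hf.re_sub_eq gi hg.im_sub_eq a b
    have e2 := integral_deriv_mul_add_of_sub_eq fi hf.im_sub_eq gr hg.re_sub_eq a b
    have e3 := intervalIntegral.integral_add (μ := volume)
      ((key fr cgi).add (key' gi cfr)) ((key fi cgr).add (key' gr cfi))
    have : (f b * g b - f a * g a).im = ((f b).re * (g b).im - (f a).re * (g a).im) +
        ((f b).im * (g b).re - (f a).im * (g a).re) := by
      simp only [Complex.sub_im, Complex.mul_im]; ring
    rw [this, e1, e2]
    refine e3.symm.trans (intervalIntegral.integral_congr fun x _ => ?_)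
    simp only [Complex.add_im, Complex.mul_im]; ring

theorem of_contDiff {φ : ℝ → ℝ} (hφ : ContDiff ℝ ∞ φ) :
    IsPrimitive (fun x => (φ x : ℂ)) (fun x => ((deriv φ x : ℝ) : ℂ)) := by
  have hc : Continuous (deriv φ) := hφ.continuous_deriv (by simp)
  refine ⟨(Complex.continuous_ofReal.comp hc).locallyIntegrable, fun a b => ?_⟩
  rw [intervalIntegral.integral_ofReal, intervalIntegral.integral_deriv_eq_sub
    (fun x _ => (hφ.differentiable (by simp)).differentiableAt) (hc.intervalIntegrable _ _)]
  push_cast; rfl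

/-- A primitive satisfies the weak derivative identity. -/
theorem integral_deriv_smul (hf : IsPrimitive f f') {φ : ℝ → ℝ} (hφ : ContDiff ℝ ∞ φ)
    (hc : HasCompactSupport φ) : ∫ x, deriv φ x • f x = -∫ x, φ x • f' x := by
  have hp := (of_contDiff hφ).mul hf
  obtain ⟨R, hR⟩ := hc.isCompact.isBounded.subset_closedBall 0
  have hout : ∀ x, R < |x| → φ x = 0 := fun x hx => by
    by_contra h
    have := hR (subset_tsupport φ h)
    rw [mem_closedBall_zero_iff, Real.norm_eq_abs] at this
    linarith
  have hR1 : R < |-(|R| + 1)| := by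
    rw [abs_neg]; exact lt_of_lt_of_le (by linarith [le_abs_self R]) (le_abs_self _)
  have hR2 : R < |(|R| + 1)| := lt_of_lt_of_le (by linarith [le_abs_self R]) (le_abs_self _)
  have h1 := hp.sub_eq (-(|R| + 1)) (|R| + 1)
  rw [hout _ hR1, hout _ hR2] at h1
  simp only [Complex.ofReal_zero, zero_mul, sub_self] at h1
  have i1 : Integrable fun x => deriv φ x • f x :=
    (hf.continuous.locallyIntegrable (μ := volume)).integrable_smul_left_of_hasCompactSupport
      (hφ.continuous_deriv (by simp)) hc.deriv
  have i2 : Integrable fun x => φ x • f' x :=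
    hf.locallyIntegrable.integrable_smul_left_of_hasCompactSupport hφ.continuous hc
  rw [eq_neg_iff_add_eq_zero, ← integral_add i1 i2, h1]
  have hs : Function.support (fun x => deriv φ x • f x + φ x • f' x) ⊆
      Set.Ioc (-(|R| + 1)) (|R| + 1) := by
    intro x hx
    have hx' : x ∈ tsupport φ := by
      by_contra hn
      have h2 : φ x = 0 := image_eq_zero_of_notMem_tsupport hn
      have h3 : deriv φ x = 0 := by
        by_contra h4
        exact hn (support_deriv_subset h4)
      exact hx (by simp [h2, h3])
    have := hR hx'
    rw [mem_closedBall_zero_iff, Real.norm_eq_abs, abs_le] at this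
    constructor <;> linarith [le_abs_self R]
  rw [← intervalIntegral.integral_eq_integral_of_support_subset hs]
  refine intervalIntegral.integral_congr fun x _ => ?_
  simp only [Complex.real_smul]

theorem intervalIntegral (hf' : LocallyIntegrable f' volume) (c : ℂ) :
    IsPrimitive (fun x => c + ∫ t in (0 : ℝ)..x, f' t) f' := by
  refine ⟨hf', fun a b => ?_⟩
  have h := locallyIntegrable_intervalIntegrable hf'
  rw [add_sub_add_left_eq_sub, intervalIntegral.integral_interval_sub_left (h _ _) (h _ _)]

end IsPrimitive

/-- A smooth compactly supported function with zero integral is the derivative of one. -/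
theorem exists_contDiff_deriv_eq {θ : ℝ → ℝ} (hθ : ContDiff ℝ ∞ θ) (hc : HasCompactSupport θ)
    (h0 : ∫ x, θ x = 0) :
    ∃ φ : ℝ → ℝ, ContDiff ℝ ∞ φ ∧ HasCompactSupport φ ∧ deriv φ = θ := by
  obtain ⟨R, hR⟩ := hc.isCompact.isBounded.subset_closedBall 0
  have hout : ∀ x, R < |x| → θ x = 0 := fun x hx => by
    by_contra h
    have := hR (subset_tsupport θ h)
    rw [mem_closedBall_zero_iff, Real.norm_eq_abs] at this
    linarith
  set φ : ℝ → ℝ := fun x => ∫ t in (-(|R| + 1))..x, θ t with hφ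
  have hd : ∀ x, HasDerivAt φ (θ x) x := fun x =>
    intervalIntegral.integral_hasDerivAt_right (hθ.continuous.intervalIntegrable _ _)
      (hθ.continuous.stronglyMeasurableAtFilter _ _) hθ.continuous.continuousAt
  have hde : deriv φ = θ := funext fun x => (hd x).deriv
  refine ⟨φ, ?_, ?_, hde⟩
  · rw [contDiff_infty_iff_deriv]
    exact ⟨fun x => (hd x).differentiableAt, hde ▸ hθ⟩
  · refine HasCompactSupport.intro (isCompact_closedBall (0 : ℝ) (|R| + 1)) fun x hx => ?_
    rw [mem_closedBall_zero_iff, Real.norm_eq_abs, not_le] at hx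
    have hR' := le_abs_self R
    rcases lt_abs.1 hx with h | h
    · have hs : Function.support θ ⊆ Set.Ioc (-(|R| + 1)) x := fun y hy => by
        by_contra hn
        refine hy (hout y ?_)
        rw [Set.mem_Ioc, not_and_or, not_lt, not_le] at hn
        rcases hn with hn | hn
        · exact lt_abs.2 (Or.inr (by linarith))
        · exact lt_abs.2 (Or.inl (by linarith))
      rw [hφ, ← h0]
      exact intervalIntegral.integral_eq_integral_of_support_subset hs
    · rw [hφ]
      refine (intervalIntegral.integral_congr (g := fun _ => 0) fun y hy => ?_).trans (by simp)
      rw [Set.uIcc_of_ge (by linarith)] at hy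
      exact hout y (lt_abs.2 (Or.inr (by linarith [hy.2])))

/-- A locally integrable function with vanishing weak derivative is constant. -/
theorem ae_eq_const_of_integral_deriv_smul_eq_zero {g : ℝ → ℂ} (hg : LocallyIntegrable g volume)
    (h : ∀ φ : ℝ → ℝ, ContDiff ℝ ∞ φ → HasCompactSupport φ → ∫ x, deriv φ x • g x = 0) :
    ∃ c : ℂ, ∀ᵐ x, g x = c := by
  obtain ⟨b⟩ : Nonempty (ContDiffBump (0 : ℝ)) := inferInstance
  set η : ℝ → ℝ := b.normed volume with hη
  have hηs : ContDiff ℝ ∞ η := b.contDiff_normed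
  have hηc : HasCompactSupport η := b.hasCompactSupport_normed
  refine ⟨∫ x, η x • g x, ae_eq_of_integral_contDiff_smul_eq hg (locallyIntegrable_const _)
    fun ψ hψ hψc => ?_⟩
  have hηi : Integrable η := hηs.continuous.integrable_of_hasCompactSupport hηc
  have hψi : Integrable ψ := hψ.continuous.integrable_of_hasCompactSupport hψc
  -- Subtracting the multiple of the unit-mass bump `η` that cancels the integral makes `ψ` a
  -- derivative of a test function; the constant is therefore the `η`-average of `g`.
  obtain ⟨φ, hφ, hφc, hd⟩ := exists_contDiff_deriv_eq
    (θ := fun x => ψ x - (∫ y, ψ y) * η x) (hψ.sub (contDiff_const.mul hηs))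
    (hψc.sub hηc.mul_left) (by
      rw [integral_sub hψi (hηi.const_mul _), integral_const_mul, hη, b.integral_normed]; simp)
  have h1 := h φ hφ hφc
  rw [hd] at h1
  simp only [sub_smul] at h1
  have i1 : Integrable fun x => ψ x • g x :=
    hg.integrable_smul_left_of_hasCompactSupport hψ.continuous hψc
  have i2 : Integrable fun x => η x • g x :=
    hg.integrable_smul_left_of_hasCompactSupport hηs.continuous hηc
  simp only [mul_smul] at h1
  have i3 : Integrable fun x => (∫ y, ψ y) • η x • g x := by
    have := i2.smul (∫ y, ψ y)
    exact this
  rw [integral_sub i1 i3, integral_smul, sub_eq_zero] at h1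
  rw [h1, integral_smul_const]

/-- A function with a weak derivative has a representative that is a primitive of it. -/
theorem HasWeakDeriv.exists_isPrimitive {u v : L2} (h : HasWeakDeriv u v) :
    ∃ f : ℝ → ℂ, IsPrimitive f v ∧ ∀ᵐ x, u x = f x := by
  have hu : LocallyIntegrable (u : ℝ → ℂ) volume :=
    (Lp.memLp u).locallyIntegrable (by norm_num)
  have hv : LocallyIntegrable (v : ℝ → ℂ) volume :=
    (Lp.memLp v).locallyIntegrable (by norm_num)
  have hp := IsPrimitive.intervalIntegral hv 0
  set f₀ := fun x => (0 : ℂ) + ∫ t in (0 : ℝ)..x, v t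
  have hf₀ : LocallyIntegrable f₀ volume := hp.continuous.locallyIntegrable
  obtain ⟨c, hc⟩ := ae_eq_const_of_integral_deriv_smul_eq_zero (hu.sub hf₀)
    fun φ hφ hφc => by
      have hd : Continuous (deriv φ) := hφ.continuous_deriv (by simp)
      simp only [Pi.sub_apply, smul_sub]
      rw [integral_sub (hu.integrable_smul_left_of_hasCompactSupport hd hφc.deriv)
        (hf₀.integrable_smul_left_of_hasCompactSupport hd hφc.deriv), h φ hφ hφc,
        hp.integral_deriv_smul hφ hφc, sub_self]
  refine ⟨_, IsPrimitive.intervalIntegral hv c, ?_⟩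
  filter_upwards [hc] with x hx
  simp only [Pi.sub_apply, f₀] at hx
  rw [← hx]; ring

theorem IsPrimitive.hasWeakDeriv {u v : L2} {f f' : ℝ → ℂ} (hf : IsPrimitive f f')
    (hu : ∀ᵐ x, u x = f x) (hv : ∀ᵐ x, v x = f' x) : HasWeakDeriv u v := by
  intro φ hφ hc
  rw [integral_congr_ae (g := fun x => deriv φ x • f x),
    integral_congr_ae (f := fun x => φ x • v x) (g := fun x => φ x • f' x),
    hf.integral_deriv_smul hφ hc]
  · filter_upwards [hv] with x hx; rw [hx]
  · filter_upwards [hu] with x hx; rw [hx]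

/-! ### The space `Ĥ¹`: completeness, sup bound, algebra structure -/

/-- The weighted function `⟨x⟩ u`, from `Ĥ¹` to `L²`. -/
def wt : Hhat1 →L[ℂ] L2 :=
  (PiLp.proj 2 (fun _ : Fin 3 => L2) (2 : Fin 3)).comp Hhat1.subtypeL

theorem hasWeakDeriv_dx (u : Hhat1) : HasWeakDeriv (fn u) (dx u) := u.2.1

theorem wt_ae_eq (u : Hhat1) : ∀ᵐ x : ℝ, wt u x = (bracket x : ℂ) * fn u x := u.2.2

theorem inner_Hhat1 (u v : Hhat1) :
    inner ℂ u v = inner ℂ (fn u) (fn v) + inner ℂ (dx u) (dx v) + inner ℂ (wt u) (wt v) := by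
  change inner ℂ u.1 v.1 = _
  rw [PiLp.inner_apply, Fin.sum_univ_three]
  rfl

theorem norm_sq_Hhat1_eq (u : Hhat1) : ‖u‖ ^ 2 = ‖fn u‖ ^ 2 + ‖dx u‖ ^ 2 + ‖wt u‖ ^ 2 := by
  change ‖u.1‖ ^ 2 = _
  rw [PiLp.norm_sq_eq_of_L2, Fin.sum_univ_three]
  rfl

theorem norm_fn_le (u : Hhat1) : ‖fn u‖ ≤ ‖u‖ := PiLp.norm_apply_le u.1 0

theorem norm_dx_le (u : Hhat1) : ‖dx u‖ ≤ ‖u‖ := PiLp.norm_apply_le u.1 1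

theorem norm_wt_le (u : Hhat1) : ‖wt u‖ ≤ ‖u‖ := PiLp.norm_apply_le u.1 2

theorem norm_Hhat1_le (u : Hhat1) : ‖u‖ ≤ ‖fn u‖ + ‖dx u‖ + ‖wt u‖ := by
  refine abs_le_of_sq_le_sq' ?_ (by positivity) |>.2
  rw [norm_sq_Hhat1_eq]
  nlinarith [norm_nonneg (fn u), norm_nonneg (dx u), norm_nonneg (wt u),
    mul_nonneg (norm_nonneg (fn u)) (norm_nonneg (dx u)),
    mul_nonneg (norm_nonneg (fn u)) (norm_nonneg (wt u)),
    mul_nonneg (norm_nonneg (dx u)) (norm_nonneg (wt u))]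

theorem L2.norm_sq_eq_integral (f : L2) : ‖f‖ ^ 2 = ∫ x, ‖f x‖ ^ 2 := by
  have h2 : (inner ℂ f f : ℂ) = ((‖f‖ ^ 2 : ℝ) : ℂ) := by
    rw [inner_self_eq_norm_sq_to_K]; norm_cast
  rw [MeasureTheory.L2.inner_def] at h2
  have h3 : (∫ x, (inner ℂ (f x) (f x) : ℂ)) = ((∫ x, ‖f x‖ ^ 2 : ℝ) : ℂ) := by
    rw [← integral_complex_ofReal]
    refine integral_congr_ae (Filter.Eventually.of_forall fun x => ?_)
    simp only [inner_self_eq_norm_sq_to_K]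
    norm_cast
  rw [h3] at h2
  exact_mod_cast h2.symm

theorem continuous_bracket : Continuous bracket := by
  unfold bracket; fun_prop

theorem continuous_integral_test_smul {φ : ℝ → ℝ} (hφ : Continuous φ)
    (hc : HasCompactSupport φ) : Continuous fun u : L2 => ∫ x, φ x • u x := by
  have hm : MemLp (fun x => (φ x : ℂ)) 2 (volume : Measure ℝ) :=
    (Complex.continuous_ofReal.comp hφ).memLp_of_hasCompactSupport
      (hc.comp_left Complex.ofReal_zero)
  have h : (fun u : L2 => ∫ x, φ x • u x) = fun u => inner ℂ hm.toLp u := by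
    funext u
    rw [MeasureTheory.L2.inner_def]
    refine integral_congr_ae ?_
    filter_upwards [hm.coeFn_toLp] with x hx
    rw [hx]
    simp [mul_comm]
  rw [h]
  exact continuous_const.inner continuous_id

/-- Tested against smooth functions, the pointwise relation becomes a family of equations between
continuous functionals on `L²`. This form makes it visibly closed, hence `Ĥ¹` complete. -/
theorem ae_eq_bracket_mul_iff (a b : L2) :
    (∀ᵐ x : ℝ, b x = (bracket x : ℂ) * a x) ↔
      ∀ φ : ℝ → ℝ, ContDiff ℝ ∞ φ → HasCompactSupport φ →
        ∫ x, φ x • b x = ∫ x, (φ x * bracket x) • a x := by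
  constructor
  · intro h φ _ _
    refine integral_congr_ae ?_
    filter_upwards [h] with x hx
    rw [hx]; simp [mul_assoc]
  · intro h
    have ha : LocallyIntegrable (a : ℝ → ℂ) volume :=
      (Lp.memLp a).locallyIntegrable (by norm_num)
    refine ae_eq_of_integral_contDiff_smul_eq ((Lp.memLp b).locallyIntegrable (by norm_num))
      ?_ fun φ hφ hc => ?_
    · simp only [mul_comm _ (a _)]
      exact IsPrimitive.locallyIntegrable_mul_continuous ha
        (Complex.continuous_ofReal.comp continuous_bracket)
    · rw [h φ hφ hc]
      refine integral_congr_ae (Filter.Eventually.of_forall fun x => ?_)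
      simp [mul_assoc]

theorem isClosed_Hhat1 : IsClosed (Hhat1 : Set (PiLp 2 fun _ : Fin 3 => L2)) := by
  have h0 : ∀ i, Continuous fun w : PiLp 2 (fun _ : Fin 3 => L2) => w i := fun i =>
    (PiLp.proj (𝕜 := ℂ) 2 (fun _ : Fin 3 => L2) i).continuous
  have h : (Hhat1 : Set (PiLp 2 fun _ : Fin 3 => L2)) =
      {w | ∀ φ : ℝ → ℝ, ContDiff ℝ ∞ φ → HasCompactSupport φ →
        ∫ x, deriv φ x • w 0 x = -∫ x, φ x • w 1 x} ∩
      {w | ∀ φ : ℝ → ℝ, ContDiff ℝ ∞ φ → HasCompactSupport φ →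
        ∫ x, φ x • w 2 x = ∫ x, (φ x * bracket x) • w 0 x} := by
    ext w
    exact and_congr Iff.rfl (ae_eq_bracket_mul_iff _ _)
  rw [h]
  refine IsClosed.inter ?_ ?_
  · simp only [Set.ofPred_forall]
    refine isClosed_iInter fun φ => isClosed_iInter fun hφ => isClosed_iInter fun hc => ?_
    exact isClosed_eq ((continuous_integral_test_smul (hφ.continuous_deriv (by simp))
      hc.deriv).comp (h0 0)) ((continuous_integral_test_smul hφ.continuous hc).comp (h0 1)).neg
  · simp only [Set.ofPred_forall]
    refine isClosed_iInter fun φ => isClosed_iInter fun hφ => isClosed_iInter fun hc => ?_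
    exact isClosed_eq ((continuous_integral_test_smul hφ.continuous hc).comp (h0 2))
      ((continuous_integral_test_smul (hφ.continuous.mul continuous_bracket)
        hc.mul_right).comp (h0 0))

instance : CompleteSpace Hhat1 := isClosed_Hhat1.completeSpace_coe

/-- The weak derivative and the weighted function of the zero function both vanish. Identities in
`Ĥ¹` can therefore be checked on the underlying functions alone, and `fn` is injective. -/
theorem Hhat1.ext_fn {u v : Hhat1} (h : fn u = fn v) : u = v := by
  rw [← sub_eq_zero]
  set w := u - v with hw
  have h0 : fn w = 0 := by rw [hw, map_sub, h, sub_self]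
  have h1 : dx w = 0 := by
    have hd := hasWeakDeriv_dx w
    rw [h0] at hd
    have hz : ∀ᵐ x : ℝ, dx w x = 0 := by
      refine ae_eq_zero_of_integral_contDiff_smul_eq_zero
        ((Lp.memLp (dx w)).locallyIntegrable (by norm_num)) fun φ hφ hc => ?_
      have h2 := hd φ hφ hc
      have h3 : ∫ x, deriv φ x • (0 : L2) x = 0 := by
        rw [integral_congr_ae (g := fun _ => (0 : ℂ)), integral_zero]
        filter_upwards with x
        simp
      rw [h3] at h2
      exact neg_eq_zero.1 h2.symm
    exact (Lp.eq_zero_iff_ae_eq_zero).2 hz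
  have h2 : wt w = 0 := by
    refine (Lp.eq_zero_iff_ae_eq_zero).2 ?_
    filter_upwards [wt_ae_eq w] with x hx
    rw [hx, h0]
    simp
  have h3 := norm_sq_Hhat1_eq w
  rw [h0, h1, h2] at h3
  simpa using h3

theorem Hhat1.ext_ae {u v : Hhat1} (h : ∀ᵐ x : ℝ, fn u x = fn v x) : u = v :=
  Hhat1.ext_fn (Lp.ext h)

/-- A unit interval is a probability space, on which the `L¹` norm is at most the `L²` norm. -/
theorem integral_norm_unit_le (f : L2) (a : ℝ) : ∫ x in a..a + 1, ‖f x‖ ≤ ‖f‖ := by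
  have hp : IsProbabilityMeasure ((volume : Measure ℝ).restrict (Set.Ioc a (a + 1))) :=
    ⟨by simp⟩
  rw [intervalIntegral.integral_of_le (by linarith), integral_norm_eq_lintegral_enorm
    (Lp.aestronglyMeasurable f).restrict, Lp.norm_def, ← eLpNorm_one_eq_lintegral_enorm]
  refine ENNReal.toReal_mono (Lp.eLpNorm_ne_top f) ?_
  calc eLpNorm f 1 (volume.restrict (Set.Ioc a (a + 1)))
      ≤ eLpNorm f 2 (volume.restrict (Set.Ioc a (a + 1))) :=
        eLpNorm_le_eLpNorm_of_exponent_le (by norm_num) (Lp.aestronglyMeasurable f).restrict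
    _ ≤ eLpNorm f 2 volume := eLpNorm_mono_measure _ Measure.restrict_le_self

/-- The embedding `Ĥ¹ ⊂ L^∞`. -/
theorem ae_norm_fn_le (u : Hhat1) : ∀ᵐ x : ℝ, ‖fn u x‖ ≤ 2 * ‖u‖ := by
  obtain ⟨f, hf, hu⟩ := (hasWeakDeriv_dx u).exists_isPrimitive
  have hi := locallyIntegrable_intervalIntegrable hf.locallyIntegrable
  filter_upwards [hu] with x hx
  rw [hx]
  -- Averaging this over `y` in a unit interval bounds `‖f x‖` by the `L²` norms of `u` and `∂ₓu`,
  -- which gives the constant 2.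
  have hy : ∀ y ∈ Set.Icc x (x + 1), ‖f x‖ ≤ ‖f y‖ + ‖dx u‖ := by
    intro y hy
    have h1 : f x = f y - ∫ t in x..y, dx u t := by rw [← hf.sub_eq]; ring
    have h2 : ‖∫ t in x..y, dx u t‖ ≤ ‖dx u‖ := by
      refine (intervalIntegral.norm_integral_le_integral_norm hy.1).trans
        (le_trans ?_ (integral_norm_unit_le (dx u) x))
      exact intervalIntegral.integral_mono_interval le_rfl hy.1 hy.2
        (Filter.Eventually.of_forall fun t => norm_nonneg _) (hi _ _).norm
    rw [h1]
    exact (norm_sub_le _ _).trans (by linarith)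
  have h3 : ∫ _ in x..x + 1, ‖f x‖ ≤ ∫ y in x..x + 1, (‖f y‖ + ‖dx u‖) :=
    intervalIntegral.integral_mono_on (by linarith) (by simp)
      ((hf.continuous.norm.add continuous_const).intervalIntegrable _ _) hy
  rw [intervalIntegral.integral_add (hf.continuous.norm.intervalIntegrable _ _) (by simp)] at h3
  simp only [intervalIntegral.integral_const, add_sub_cancel_left, one_smul] at h3
  have h4 : ∫ y in x..x + 1, ‖f y‖ = ∫ y in x..x + 1, ‖fn u y‖ := by
    refine intervalIntegral.integral_congr_ae ?_
    filter_upwards [hu] with y hy _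
    rw [hy]
  linarith [integral_norm_unit_le (fn u) x, norm_fn_le u, norm_dx_le u]

theorem memLp_mul_of_bounded {f g : ℝ → ℂ} (hf : MemLp f 2 volume)
    (hg : AEStronglyMeasurable g volume) {M : ℝ} (hM : ∀ᵐ x, ‖g x‖ ≤ M) :
    MemLp (fun x => f x * g x) 2 volume := by
  refine hf.of_le_mul (c := M) (hf.aestronglyMeasurable.mul hg) ?_
  filter_upwards [hM] with x hx
  rw [norm_mul, mul_comm]
  exact mul_le_mul_of_nonneg_right hx (norm_nonneg _)

/-- The pointwise product of an `L²` function with an element of `Ĥ¹`. -/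
def mulL2 (f : L2) (v : Hhat1) : L2 :=
  (memLp_mul_of_bounded (Lp.memLp f) (Lp.aestronglyMeasurable (fn v)) (ae_norm_fn_le v)).toLp

theorem mulL2_ae_eq (f : L2) (v : Hhat1) : ∀ᵐ x : ℝ, mulL2 f v x = f x * fn v x :=
  MemLp.coeFn_toLp _

theorem norm_mulL2_le (f : L2) (v : Hhat1) : ‖mulL2 f v‖ ≤ 2 * ‖v‖ * ‖f‖ := by
  refine Lp.norm_le_mul_norm_of_ae_le_mul ?_
  filter_upwards [mulL2_ae_eq f v, ae_norm_fn_le v] with x h1 h2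
  rw [h1, norm_mul, mul_comm]
  exact mul_le_mul_of_nonneg_right h2 (norm_nonneg _)

/-- The pointwise product on `Ĥ¹`. -/
def mul (u v : Hhat1) : Hhat1 :=
  ⟨WithLp.toLp 2 ![mulL2 (fn u) v, mulL2 (dx u) v + mulL2 (dx v) u, mulL2 (wt u) v], by
    constructor
    · obtain ⟨f, hf, hfu⟩ := (hasWeakDeriv_dx u).exists_isPrimitive
      obtain ⟨g, hg, hgv⟩ := (hasWeakDeriv_dx v).exists_isPrimitive
      refine (hf.mul hg).hasWeakDeriv ?_ ?_
      · filter_upwards [mulL2_ae_eq (fn u) v, hfu, hgv] with x h1 h2 h3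
        change mulL2 (fn u) v x = _
        rw [h1, h2, h3]
      · filter_upwards [mulL2_ae_eq (dx u) v, mulL2_ae_eq (dx v) u, hfu, hgv,
          Lp.coeFn_add (mulL2 (dx u) v) (mulL2 (dx v) u)] with x h1 h2 h3 h4 h5
        change (mulL2 (dx u) v + mulL2 (dx v) u) x = _
        rw [h5, Pi.add_apply, h1, h2, h3, h4]
        ring
    · filter_upwards [mulL2_ae_eq (wt u) v, mulL2_ae_eq (fn u) v, wt_ae_eq u] with x h1 h2 h3
      change mulL2 (wt u) v x = _ * mulL2 (fn u) v x
      rw [h1, h2, h3]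
      ring⟩

theorem fn_mul_eq (u v : Hhat1) : fn (mul u v) = mulL2 (fn u) v := rfl

theorem fn_mul (u v : Hhat1) : ∀ᵐ x : ℝ, fn (mul u v) x = fn u x * fn v x :=
  mulL2_ae_eq (fn u) v

/-- Four products occur: one in the function, two in the derivative and one in the weight. Each
costs the factor 2 of the sup bound. -/
theorem norm_mul_Hhat1_le (u v : Hhat1) : ‖mul u v‖ ≤ 8 * ‖u‖ * ‖v‖ := by
  have h1 : ‖fn (mul u v)‖ ≤ 2 * ‖v‖ * ‖fn u‖ := norm_mulL2_le _ _
  have h2 : ‖dx (mul u v)‖ ≤ 2 * ‖v‖ * ‖dx u‖ + 2 * ‖u‖ * ‖dx v‖ :=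
    (norm_add_le _ _).trans (add_le_add (norm_mulL2_le _ _) (norm_mulL2_le _ _))
  have h3 : ‖wt (mul u v)‖ ≤ 2 * ‖v‖ * ‖wt u‖ := norm_mulL2_le _ _
  have h4 := norm_Hhat1_le (mul u v)
  have a1 := mul_le_mul_of_nonneg_left (norm_fn_le u) (norm_nonneg v)
  have a2 := mul_le_mul_of_nonneg_left (norm_dx_le u) (norm_nonneg v)
  have a3 := mul_le_mul_of_nonneg_left (norm_dx_le v) (norm_nonneg u)
  have a4 := mul_le_mul_of_nonneg_left (norm_wt_le u) (norm_nonneg v)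
  linarith [mul_comm ‖u‖ ‖v‖]

theorem mul_comm_Hhat1 (u v : Hhat1) : mul u v = mul v u := by
  refine Hhat1.ext_ae ?_
  filter_upwards [fn_mul u v, fn_mul v u] with x h1 h2
  rw [h1, h2, mul_comm]

theorem fn_sub_ae (u v : Hhat1) : ∀ᵐ x : ℝ, fn (u - v) x = fn u x - fn v x := by
  rw [map_sub]; exact Lp.coeFn_sub _ _

theorem fn_add_ae (u v : Hhat1) : ∀ᵐ x : ℝ, fn (u + v) x = fn u x + fn v x := by
  rw [map_add]; exact Lp.coeFn_add _ _

theorem fn_smul_ae (c : ℂ) (u : Hhat1) : ∀ᵐ x : ℝ, fn (c • u) x = c * fn u x := by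
  rw [map_smul]; exact Lp.coeFn_smul _ _

theorem mul_sub_Hhat1 (u v w : Hhat1) : mul u (v - w) = mul u v - mul u w := by
  refine Hhat1.ext_ae ?_
  filter_upwards [fn_mul u (v - w), fn_mul u v, fn_mul u w, fn_sub_ae v w,
    fn_sub_ae (mul u v) (mul u w)] with x h1 h2 h3 h4 h5
  rw [h1, h5, h2, h3, h4, mul_sub]

theorem sub_mul_Hhat1 (u v w : Hhat1) : mul (u - v) w = mul u w - mul v w := by
  rw [mul_comm_Hhat1, mul_sub_Hhat1, mul_comm_Hhat1 w u, mul_comm_Hhat1 w v]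

theorem coeFn_star_L2 (f : L2) : ∀ᵐ x : ℝ, (star f : L2) x = (starRingEnd ℂ) (f x) :=
  Lp.coeFn_star f

theorem norm_star_L2 (f : L2) : ‖(star f : L2)‖ = ‖f‖ := by
  rw [Lp.norm_def, Lp.norm_def]
  congr 1
  refine eLpNorm_congr_norm_ae ?_
  filter_upwards [coeFn_star_L2 f] with x hx
  rw [hx, RCLike.norm_conj]

/-- Complex conjugation on `Ĥ¹`. -/
def conj (u : Hhat1) : Hhat1 :=
  ⟨WithLp.toLp 2 ![star (fn u), star (dx u), star (wt u)], by
    have hintg : ∀ (ψ : ℝ → ℝ) (f : L2),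
        ∫ x, ψ x • (star f : L2) x = (starRingEnd ℂ) (∫ x, ψ x • f x) := by
      intro ψ f
      rw [← integral_conj]
      refine integral_congr_ae ?_
      filter_upwards [coeFn_star_L2 f] with x hx
      rw [hx]
      simp
    constructor
    · intro φ hφ hc
      change ∫ x, deriv φ x • (star (fn u) : L2) x = -∫ x, φ x • (star (dx u) : L2) x
      rw [hintg, hintg, hasWeakDeriv_dx u φ hφ hc, map_neg]
    · filter_upwards [coeFn_star_L2 (fn u), coeFn_star_L2 (wt u), wt_ae_eq u] with x h1 h2 h3
      change (star (wt u) : L2) x = _ * (star (fn u) : L2) x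
      rw [h1, h2, h3]
      simp⟩

theorem fn_conj_eq (u : Hhat1) : fn (conj u) = star (fn u) := rfl

theorem dx_conj_eq (u : Hhat1) : dx (conj u) = star (dx u) := rfl

theorem wt_conj_eq (u : Hhat1) : wt (conj u) = star (wt u) := rfl

theorem fn_conj (u : Hhat1) : ∀ᵐ x : ℝ, fn (conj u) x = (starRingEnd ℂ) (fn u x) :=
  coeFn_star_L2 (fn u)

theorem norm_fn_conj (u : Hhat1) : ‖fn (conj u)‖ = ‖fn u‖ := norm_star_L2 _

theorem norm_conj_Hhat1 (u : Hhat1) : ‖conj u‖ = ‖u‖ := by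
  have h := norm_sq_Hhat1_eq (conj u)
  rw [fn_conj_eq, dx_conj_eq, wt_conj_eq, norm_star_L2, norm_star_L2, norm_star_L2,
    ← norm_sq_Hhat1_eq] at h
  exact (sq_eq_sq₀ (norm_nonneg _) (norm_nonneg _)).1 h

theorem conj_conj_Hhat1 (u : Hhat1) : conj (conj u) = u :=
  Hhat1.ext_fn (star_star (fn u))

theorem conj_sub (u v : Hhat1) : conj (u - v) = conj u - conj v := by
  refine Hhat1.ext_ae ?_
  filter_upwards [fn_conj (u - v), fn_conj u, fn_conj v, fn_sub_ae u v,
    fn_sub_ae (conj u) (conj v)] with x h1 h2 h3 h4 h5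
  rw [h1, h5, h2, h3, h4, map_sub]

/-! ### The unitary group generated by the inverse of an injective self-adjoint operator -/

/-- The function `z ↦ z exp(-it/z)` on the real line. -/
def phase (t : ℝ) (z : ℂ) : ℂ := z * Complex.exp (Complex.I * ((-(t / z.re) : ℝ) : ℂ))

theorem norm_phase (t : ℝ) (z : ℂ) : ‖phase t z‖ = ‖z‖ := by
  rw [phase, norm_mul, Complex.norm_exp_I_mul_ofReal, mul_one]

theorem norm_exp_I_sub_exp_I_le (a b : ℝ) :
    ‖Complex.exp (Complex.I * (a : ℂ)) - Complex.exp (Complex.I * (b : ℂ))‖ ≤ |a - b| := by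
  have h : Complex.exp (Complex.I * (a : ℂ)) - Complex.exp (Complex.I * (b : ℂ)) =
      Complex.exp (Complex.I * (b : ℂ)) * (Complex.exp (Complex.I * ((a - b : ℝ) : ℂ)) - 1) := by
    rw [mul_sub, ← Complex.exp_add, mul_one]
    congr 2
    push_cast; ring
  rw [h, norm_mul, Complex.norm_exp_I_mul_ofReal, one_mul]
  exact Real.norm_exp_I_mul_ofReal_sub_one_le

/-- The Taylor bound covers `|a| ≤ 1`; beyond that the trivial bound `2|a|` is already at most
`3a²`. -/
theorem norm_exp_I_sub_one_sub_le (a : ℝ) :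
    ‖Complex.exp (Complex.I * (a : ℂ)) - 1 - Complex.I * (a : ℂ)‖ ≤ 3 * a ^ 2 := by
  have hn : ‖Complex.I * (a : ℂ)‖ = |a| := by simp
  by_cases ha : |a| ≤ 1
  · have h := Complex.norm_exp_sub_one_sub_id_le (x := Complex.I * (a : ℂ)) (by rw [hn]; exact ha)
    rw [hn, sq_abs] at h
    nlinarith [sq_nonneg a]
  · have h1 : 1 ≤ |a| := (not_le.1 ha).le
    have h2 : ‖Complex.exp (Complex.I * (a : ℂ)) - 1‖ ≤ |a| :=
      Real.norm_exp_I_mul_ofReal_sub_one_le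
    have h3 := norm_sub_le (Complex.exp (Complex.I * (a : ℂ)) - 1) (Complex.I * (a : ℂ))
    rw [hn] at h3
    rw [← sq_abs]
    nlinarith

/-- The oscillation at `0` is harmless because `|phase t z| = |z|`. This is why `A exp(-itA⁻¹)`,
rather than the group itself, is within reach of the continuous functional calculus. -/
theorem continuousOn_phase (t : ℝ) {s : Set ℂ} (hs : ∀ z ∈ s, z = z.re) :
    ContinuousOn (phase t) s := by
  intro z hz
  by_cases h : z.re = 0
  · have hz0 : z = 0 := by rw [hs z hz, h]; rfl
    refine ContinuousAt.continuousWithinAt ?_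
    rw [ContinuousAt, hz0, show phase t 0 = 0 by simp [phase]]
    refine squeeze_zero_norm (a := fun z => ‖z‖) (fun z => (norm_phase t z).le) ?_
    simpa using (continuous_norm (E := ℂ)).tendsto 0
  · refine ContinuousAt.continuousWithinAt ?_
    unfold phase
    have : ContinuousAt (fun z : ℂ => -(t / z.re)) z :=
      (continuousAt_const.div Complex.continuous_re.continuousAt h).neg
    have h2 := Complex.continuous_ofReal.continuousAt.comp this
    exact continuousAt_id.mul (Complex.continuous_exp.continuousAt.comp
      (continuousAt_const.mul h2))

theorem hasDerivAt_of_quadratic_bound {E : Type*} [NormedAddCommGroup E] [NormedSpace ℝ E]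
    {f : ℝ → E} {f' : E} {t C : ℝ} (h : ∀ s, ‖f (t + s) - f t - s • f'‖ ≤ C * s ^ 2) :
    HasDerivAt f f' t := by
  rw [hasDerivAt_iff_isLittleO_nhds_zero]
  have h1 : (fun s => f (t + s) - f t - s • f') =O[nhds 0] fun s : ℝ => s ^ 2 :=
    Asymptotics.IsBigO.of_bound C (Filter.Eventually.of_forall fun s => by
      rw [norm_pow, Real.norm_eq_abs, sq_abs]; exact h s)
  exact h1.trans_isLittleO (Asymptotics.isLittleO_pow_id (by norm_num))

section Group

variable {X : Type*} [NormedAddCommGroup X] [InnerProductSpace ℂ X] [CompleteSpace X]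

/-- The operator `A exp(-itA⁻¹)`. -/
def smoothedGroup (A : X →L[ℂ] X) (t : ℝ) : X →L[ℂ] X := cfc (phase t) A

/-- The unitary group `exp(-itA⁻¹)`. -/
def unitaryGroup (A : X →L[ℂ] X) (t : ℝ) : X →L[ℂ] X :=
  (smoothedGroup A t : X →ₗ[ℂ] X).extendOfNorm (A : X →ₗ[ℂ] X)

variable {A : X →L[ℂ] X}


theorem continuousOn_phase_spectrum (hA : IsSelfAdjoint A) (t : ℝ) :
    ContinuousOn (phase t) (spectrum ℂ A) :=
  continuousOn_phase t fun _ hz => hA.mem_spectrum_eq_re hz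

/-- On the real spectrum `|phase t z|² = z²`. This gives `‖smoothedGroup A t x‖ = ‖A x‖`, which lets
the group extend from the range of `A` as an isometry. -/
theorem star_smoothedGroup_mul_self (hA : IsSelfAdjoint A) (t : ℝ) :
    star (smoothedGroup A t) * smoothedGroup A t = A * A := by
  have := hA.isStarNormal
  have hc := continuousOn_phase_spectrum hA t
  have h1 : A * A = cfc (fun z : ℂ => z * z) A := by
    rw [cfc_mul (fun z : ℂ => z) (fun z => z) A, cfc_id' ℂ A]
  rw [smoothedGroup, ← cfc_star, ← cfc_mul (fun z => star (phase t z)) _ A hc.star hc, h1]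
  refine cfc_congr fun z hz => ?_
  have hr := hA.mem_spectrum_eq_re hz
  have h2 : star (phase t z) * phase t z = ((‖phase t z‖ ^ 2 : ℝ) : ℂ) := by
    rw [mul_comm]; simpa using Complex.mul_conj' (phase t z)
  change star (phase t z) * phase t z = z * z
  rw [h2, norm_phase, hr, Complex.norm_real, Real.norm_eq_abs, sq_abs]
  push_cast; ring

theorem norm_smoothedGroup_apply (hA : IsSelfAdjoint A) (t : ℝ) (x : X) :
    ‖smoothedGroup A t x‖ = ‖A x‖ := by
  have h1 : ∀ T : X →L[ℂ] X, ((‖T x‖ ^ 2 : ℝ) : ℂ) = inner ℂ x ((star T * T) x) := by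
    intro T
    rw [mul_apply_eq_comp, ContinuousLinearMap.star_eq_adjoint,
      ContinuousLinearMap.adjoint_inner_right, inner_self_eq_norm_sq_to_K]
    norm_cast
  have h2 : ((‖smoothedGroup A t x‖ ^ 2 : ℝ) : ℂ) = ((‖A x‖ ^ 2 : ℝ) : ℂ) := by
    rw [h1, h1, star_smoothedGroup_mul_self hA, hA.star_eq]
  exact (sq_eq_sq₀ (norm_nonneg _) (norm_nonneg _)).1 (Complex.ofReal_injective h2)

theorem smoothedGroup_zero (hA : IsSelfAdjoint A) : smoothedGroup A 0 = A := by
  have := hA.isStarNormal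
  have h : phase 0 = fun z => z := by funext z; simp [phase]
  rw [smoothedGroup, h, cfc_id' ℂ A]

theorem mul_smoothedGroup (hA : IsSelfAdjoint A) (t : ℝ) :
    A * smoothedGroup A t = cfc (fun z => z * phase t z) A := by
  have := hA.isStarNormal
  rw [cfc_mul (fun z : ℂ => z) (phase t) A continuousOn_id (continuousOn_phase_spectrum hA t),
    cfc_id' ℂ A, smoothedGroup]

theorem smoothedGroup_commute (hA : IsSelfAdjoint A) (t : ℝ) (x : X) :
    smoothedGroup A t (A x) = A (smoothedGroup A t x) := by
  have h : Commute (smoothedGroup A t) (smoothedGroup A 0) := cfc_commute_cfc _ _ _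
  rw [smoothedGroup_zero hA] at h
  exact congrArg (fun T : X →L[ℂ] X => T x) h.eq

theorem smoothedGroup_mul (hA : IsSelfAdjoint A) (s t : ℝ) :
    smoothedGroup A s * smoothedGroup A t = A * smoothedGroup A (s + t) := by
  rw [mul_smoothedGroup hA, smoothedGroup, smoothedGroup,
    ← cfc_mul _ _ A (continuousOn_phase_spectrum hA s) (continuousOn_phase_spectrum hA t)]
  refine cfc_congr fun z _ => ?_
  simp only [phase]
  rw [mul_mul_mul_comm, ← Complex.exp_add, mul_assoc]
  congr 3
  push_cast; ring

/-- The factor `z` absorbs the `1/z` in the increment `(s - t)/z` of the phase: on the range of `A`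
the group is Lipschitz in time. -/
theorem norm_smoothedGroup_sub_le (hA : IsSelfAdjoint A) (s t : ℝ) :
    ‖smoothedGroup A s - smoothedGroup A t‖ ≤ |s - t| := by
  rw [smoothedGroup, smoothedGroup, ← cfc_sub _ _ A (continuousOn_phase_spectrum hA s)
    (continuousOn_phase_spectrum hA t)]
  refine norm_cfc_le (abs_nonneg _) fun z hz => ?_
  have hr := hA.mem_spectrum_eq_re hz
  rw [phase, phase, ← mul_sub, norm_mul]
  have h := norm_exp_I_sub_exp_I_le (-(s / z.re)) (-(t / z.re))
  by_cases h0 : z.re = 0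
  · rw [hr, h0]; simp
  · calc ‖z‖ * _ ≤ |z.re| * |-(s / z.re) - -(t / z.re)| := by
          rw [show ‖z‖ = |z.re| by conv_lhs => rw [hr, Complex.norm_real, Real.norm_eq_abs]]
          exact mul_le_mul_of_nonneg_left h (abs_nonneg _)
      _ = |s - t| := by
          rw [← abs_mul, ← abs_neg]
          congr 1
          field_simp
          ring

/-- A second factor `z` absorbs the `1/z²` in the second-order remainder of the exponential, so the
derivative exists with quadratic error in operator norm. -/
theorem norm_mul_smoothedGroup_sub_le (hA : IsSelfAdjoint A) (t s : ℝ) :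
    ‖A * smoothedGroup A (t + s) - A * smoothedGroup A t +
      (Complex.I * s) • smoothedGroup A t‖ ≤ 3 * s ^ 2 := by
  have := hA.isStarNormal
  have c1 := continuousOn_phase_spectrum hA (t + s)
  have c2 := continuousOn_phase_spectrum hA t
  have c3 : ContinuousOn (fun z : ℂ => z) (spectrum ℂ A) := continuousOn_id
  rw [mul_smoothedGroup hA, mul_smoothedGroup hA, smoothedGroup,
    ← cfc_sub (fun z => z * phase (t + s) z) (fun z => z * phase t z) A (c3.mul c1) (c3.mul c2),
    ← cfc_const_mul _ _ A c2,
    ← cfc_add A (fun z => z * phase (t + s) z - z * phase t z)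
      (fun z => Complex.I * s * phase t z) ((c3.mul c1).sub (c3.mul c2)) (c2.const_mul _)]
  refine norm_cfc_le (by positivity) fun z hz => ?_
  have hr := hA.mem_spectrum_eq_re hz
  by_cases h0 : z.re = 0
  · have hz0 : z = 0 := by rw [hr, h0]; rfl
    rw [hz0]; simp [phase]; positivity
  · have h0' : (z.re : ℂ) ≠ 0 := by exact_mod_cast h0
    have h1 : z * phase (t + s) z - z * phase t z + Complex.I * s * phase t z =
        phase t z * (z.re * (Complex.exp (Complex.I * ((-(s / z.re) : ℝ) : ℂ)) - 1 -
          Complex.I * ((-(s / z.re) : ℝ) : ℂ))) := by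
      have h2 : phase (t + s) z =
          phase t z * Complex.exp (Complex.I * ((-(s / z.re) : ℝ) : ℂ)) := by
        rw [phase, phase, mul_assoc, ← Complex.exp_add]
        congr 2
        push_cast; ring
      have h3 : (z.re : ℂ) * (Complex.I * ((-(s / z.re) : ℝ) : ℂ)) = -(Complex.I * s) := by
        push_cast; field_simp
      rw [h2, mul_sub (z.re : ℂ), h3, ← hr]
      ring
    have h4 : ‖z‖ = |z.re| := by conv_lhs => rw [hr, Complex.norm_real, Real.norm_eq_abs]
    rw [h1, norm_mul, norm_mul, norm_phase, Complex.norm_real, Real.norm_eq_abs, h4, ← mul_assoc,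
      ← sq, sq_abs]
    calc z.re ^ 2 * _ ≤ z.re ^ 2 * (3 * (-(s / z.re)) ^ 2) :=
          mul_le_mul_of_nonneg_left (norm_exp_I_sub_one_sub_le _) (sq_nonneg _)
      _ = 3 * s ^ 2 := by field_simp

/-- The orthogonal complement of the range is the kernel of the adjoint, that is, of `A` itself. -/
theorem denseRange_of_injective (hA : IsSelfAdjoint A) (hinj : Function.Injective A) :
    DenseRange A := by
  have h1 := A.orthogonal_range
  have h2 : ContinuousLinearMap.adjoint A = A := hA
  rw [h2, LinearMap.ker_eq_bot.2 hinj, ← Submodule.topologicalClosure_eq_top_iff,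
    ← Submodule.dense_iff_topologicalClosure_eq_top] at h1
  exact h1

theorem unitaryGroup_apply_range (hA : IsSelfAdjoint A) (hinj : Function.Injective A) (t : ℝ)
    (x : X) : unitaryGroup A t (A x) = smoothedGroup A t x :=
  LinearMap.extendOfNorm_eq (f := (smoothedGroup A t : X →ₗ[ℂ] X)) (e := (A : X →ₗ[ℂ] X))
    (denseRange_of_injective hA hinj)
    ⟨1, fun x => by simpa using (norm_smoothedGroup_apply hA t x).le⟩ x

theorem unitaryGroup_zero (hA : IsSelfAdjoint A) (hinj : Function.Injective A) (x : X) :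
    unitaryGroup A 0 x = x := by
  refine (denseRange_of_injective hA hinj).induction_on x
    (isClosed_eq (unitaryGroup A 0).continuous continuous_id) fun y => ?_
  rw [unitaryGroup_apply_range hA hinj, smoothedGroup_zero hA]

theorem unitaryGroup_commute (hA : IsSelfAdjoint A) (hinj : Function.Injective A) (t : ℝ)
    (x : X) : unitaryGroup A t (A x) = A (unitaryGroup A t x) := by
  refine (denseRange_of_injective hA hinj).induction_on x
    (isClosed_eq ((unitaryGroup A t).continuous.comp A.continuous)
      (A.continuous.comp (unitaryGroup A t).continuous)) fun y => ?_
  rw [unitaryGroup_apply_range hA hinj, unitaryGroup_apply_range hA hinj,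
    smoothedGroup_commute hA]

theorem unitaryGroup_add (hA : IsSelfAdjoint A) (hinj : Function.Injective A) (s t : ℝ) (x : X) :
    unitaryGroup A s (unitaryGroup A t x) = unitaryGroup A (s + t) x := by
  apply hinj
  rw [← unitaryGroup_commute hA hinj, ← unitaryGroup_commute hA hinj,
    ← unitaryGroup_commute hA hinj (s + t), unitaryGroup_apply_range hA hinj]
  refine (denseRange_of_injective hA hinj).induction_on x
    (isClosed_eq ((unitaryGroup A s).continuous.comp (smoothedGroup A t).continuous)
      ((unitaryGroup A (s + t)).continuous.comp A.continuous)) fun y => ?_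
  rw [unitaryGroup_apply_range hA hinj, smoothedGroup_commute hA, unitaryGroup_apply_range hA hinj,
    smoothedGroup_commute hA]
  exact congrArg (fun T : X →L[ℂ] X => T y) (smoothedGroup_mul hA s t)

theorem norm_unitaryGroup_le (hA : IsSelfAdjoint A) (hinj : Function.Injective A) (t : ℝ)
    (x : X) : ‖unitaryGroup A t x‖ ≤ ‖x‖ := by
  have h := LinearMap.norm_extendOfNorm_apply_le (f := (smoothedGroup A t : X →ₗ[ℂ] X))
    (e := (A : X →ₗ[ℂ] X)) (denseRange_of_injective hA hinj) 1
    (fun x => by simpa using (norm_smoothedGroup_apply hA t x).le) x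
  rwa [one_mul] at h

theorem unitaryGroup_neg_apply (hA : IsSelfAdjoint A) (hinj : Function.Injective A) (t : ℝ)
    (x : X) : unitaryGroup A (-t) (unitaryGroup A t x) = x := by
  rw [unitaryGroup_add hA hinj, neg_add_cancel, unitaryGroup_zero hA hinj]

theorem unitaryGroup_apply_neg (hA : IsSelfAdjoint A) (hinj : Function.Injective A) (t : ℝ)
    (x : X) : unitaryGroup A t (unitaryGroup A (-t) x) = x := by
  rw [unitaryGroup_add hA hinj, add_neg_cancel, unitaryGroup_zero hA hinj]

theorem norm_unitaryGroup (hA : IsSelfAdjoint A) (hinj : Function.Injective A) (t : ℝ)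
    (x : X) : ‖unitaryGroup A t x‖ = ‖x‖ := by
  refine le_antisymm (norm_unitaryGroup_le hA hinj t x) ?_
  conv_lhs => rw [← unitaryGroup_neg_apply hA hinj t x]
  exact norm_unitaryGroup_le hA hinj _ _

theorem inner_unitaryGroup (hA : IsSelfAdjoint A) (hinj : Function.Injective A) (t : ℝ)
    (x y : X) : inner ℂ (unitaryGroup A t x) (unitaryGroup A t y) = inner ℂ x y :=
  LinearIsometry.inner_map_map
    (⟨(unitaryGroup A t : X →ₗ[ℂ] X), norm_unitaryGroup hA hinj t⟩ : X →ₗᵢ[ℂ] X) x y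

/-- Strong continuity, jointly in time and space. -/
theorem continuous_unitaryGroup (hA : IsSelfAdjoint A) (hinj : Function.Injective A) :
    Continuous fun q : ℝ × X => unitaryGroup A q.1 q.2 := by
  have h : Continuous fun q : X × ℝ => unitaryGroup A q.2 q.1 := by
    refine continuous_prod_of_dense_continuous_lipschitzWith _ 1
      (denseRange_of_injective hA hinj) ?_ fun t => ?_
    · rintro _ ⟨y, rfl⟩
      simp only [unitaryGroup_apply_range hA hinj]
      refine (LipschitzWith.of_dist_le_mul (K := ‖y‖₊) fun s t => ?_).continuous
      rw [dist_eq_norm, dist_eq_norm, ← sub_apply, mul_comm]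
      exact ((smoothedGroup A s - smoothedGroup A t).le_opNorm y).trans
        (mul_le_mul_of_nonneg_right (norm_smoothedGroup_sub_le hA s t) (norm_nonneg _))
    · refine LipschitzWith.of_dist_le_mul fun x y => ?_
      simp only
      rw [dist_eq_norm, dist_eq_norm, ← map_sub, NNReal.coe_one, one_mul]
      exact norm_unitaryGroup_le hA hinj _ _
  have hs : Continuous fun q : ℝ × X => (q.2, q.1) := continuous_snd.prodMk continuous_fst
  have hc := Continuous.comp (g := fun q : X × ℝ => unitaryGroup A q.2 q.1) h hs
  simpa only [Function.comp_def] using hc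

/-- `d/dt (A exp(-itA⁻¹) x) = -i exp(-itA⁻¹) x`. -/
theorem hasDerivAt_unitaryGroup (hA : IsSelfAdjoint A) (hinj : Function.Injective A) (x : X)
    (t : ℝ) : HasDerivAt (fun s => A (unitaryGroup A s x)) (-Complex.I • unitaryGroup A t x) t := by
  obtain ⟨y, hy, hlim⟩ := mem_closure_iff_seq_limit.1 (denseRange_of_injective hA hinj x)
  choose z hz using hy
  have hU : ∀ s, Filter.Tendsto (fun n => unitaryGroup A s (y n)) Filter.atTop
      (nhds (unitaryGroup A s x)) := fun s => ((unitaryGroup A s).continuous.tendsto x).comp hlim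
  -- For points in the range of `A` the derivative comes from the quadratic bound. Since the group
  -- is isometric, the derivatives converge uniformly in time as `y n → x`, and differentiability
  -- passes to the limit.
  refine hasDerivAt_of_tendstoUniformly (l := Filter.atTop)
    (f := fun n s => A (unitaryGroup A s (y n)))
    (f' := fun n s => -Complex.I • unitaryGroup A s (y n)) (g' := fun s => -Complex.I •
      unitaryGroup A s x) ?_ (Filter.Eventually.of_forall fun n s => ?_)
    (fun s => (A.continuous.tendsto _).comp (hU s)) t
  · rw [Metric.tendstoUniformly_iff]
    intro ε hε
    filter_upwards [(Metric.tendsto_nhds.1 hlim) ε hε] with n hn s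
    rw [dist_eq_norm, ← smul_sub, ← map_sub, norm_smul, norm_unitaryGroup hA hinj, norm_neg,
      Complex.norm_I, one_mul, ← dist_eq_norm, dist_comm]
    exact hn
  · rw [← hz n]
    simp only [unitaryGroup_apply_range hA hinj]
    refine hasDerivAt_of_quadratic_bound (C := 3 * ‖z n‖) fun r => ?_
    have h := (A * smoothedGroup A (s + r) - A * smoothedGroup A s +
      (Complex.I * r) • smoothedGroup A s).le_opNorm (z n)
    have h2 : (A * smoothedGroup A (s + r) - A * smoothedGroup A s +
        (Complex.I * r) • smoothedGroup A s) (z n) = A (smoothedGroup A (s + r) (z n)) -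
        A (smoothedGroup A s (z n)) - r • -Complex.I • smoothedGroup A s (z n) := by
      have h3 : r • -Complex.I • smoothedGroup A s (z n) =
          -((Complex.I * r) • smoothedGroup A s (z n)) := by
        rw [← Complex.coe_smul, smul_smul, ← neg_smul]
        congr 1; ring
      rw [h3, sub_neg_eq_add]
      rfl
    rw [← h2]
    refine h.trans ((mul_le_mul_of_nonneg_right (norm_mul_smoothedGroup_sub_le hA s r)
      (norm_nonneg _)).trans (le_of_eq (by ring)))

attribute [irreducible] unitaryGroup smoothedGroup

end Group

/-! ### Global solutions of ordinary differential equations with bounded Lipschitz fields -/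

/-- A field bounded by `L` moves a solution at most `L(n + 1)` in time `n + 1`, so Picard–Lindelöf
on a ball of that radius reaches every time. Uniqueness glues the solutions. -/
theorem exists_hasDerivAt_of_lipschitz_of_bounded {E : Type*} [NormedAddCommGroup E]
    [NormedSpace ℝ E] [CompleteSpace E] {f : ℝ → E → E} {K L : NNReal}
    (hf : ∀ t, LipschitzWith K (f t)) (hc : ∀ x, Continuous fun t => f t x)
    (hb : ∀ t x, ‖f t x‖ ≤ L) (x₀ : E) :
    ∃ α : ℝ → E, α 0 = x₀ ∧ ∀ t, HasDerivAt α (f t (α t)) t := by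
  have hloc : ∀ n : ℕ, ∃ α : ℝ → E, α 0 = x₀ ∧
      ∀ t ∈ Set.Ioo (-(n + 1 : ℝ)) (n + 1), HasDerivAt α (f t (α t)) t := by
    intro n
    have hn : (0 : ℝ) ≤ n + 1 := by positivity
    have h0 : (0 : ℝ) ∈ Set.Icc (-(n + 1 : ℝ)) (n + 1) := ⟨by linarith, hn⟩
    have hpl : IsPicardLindelof f (⟨0, h0⟩ : Set.Icc (-(n + 1 : ℝ)) (n + 1)) x₀
        (L * (n + 1)) 0 L K :=
      { lipschitzOnWith := fun t _ => (hf t).lipschitzOnWith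
        continuousOn := fun x _ => (hc x).continuousOn
        norm_le := fun t _ x _ => hb t x
        mul_max_le := by simp }
    obtain ⟨α, h1, h2⟩ := hpl.exists_eq_forall_mem_Icc_hasDerivWithinAt₀
    exact ⟨α, h1, fun t ht => (h2 t (Set.Ioo_subset_Icc_self ht)).hasDerivAt
      (Icc_mem_nhds ht.1 ht.2)⟩
  choose α h0 hα using hloc
  have hagree : ∀ m n : ℕ, m ≤ n → ∀ t : ℝ, |t| < m + 1 → α m t = α n t := by
    intro m n hmn t ht
    have hmn' : (m : ℝ) ≤ n := by exact_mod_cast hmn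
    have hm : (0 : ℝ) ≤ m := by positivity
    refine ODE_solution_unique_of_mem_Ioo (v := f) (s := fun _ => Set.univ) (K := K)
      (t₀ := 0) (a := -(m + 1 : ℝ)) (b := m + 1) (fun t _ => (hf t).lipschitzOnWith)
      ⟨by linarith, by linarith⟩ (fun t ht => ⟨hα m t ht, trivial⟩)
      (fun t ht => ⟨hα n t ⟨by linarith [ht.1], by linarith [ht.2]⟩, trivial⟩)
      ((h0 m).trans (h0 n).symm) (abs_lt.1 ht)
  -- The solution `α n` lives on `|t| < n + 1`, so the index `⌈|t|⌉₊` suffices at `t`. One more than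
  -- this index serves a whole neighbourhood of `t`.
  refine ⟨fun t => α ⌈|t|⌉₊ t, h0 _, fun t => ?_⟩
  set N := ⌈|t|⌉₊ + 1 with hN
  have htN : |t| < N := by
    rw [hN]; push_cast
    linarith [Nat.le_ceil |t|]
  have hev : (fun s => α ⌈|s|⌉₊ s) =ᶠ[nhds t] α N := by
    filter_upwards [(continuous_abs.tendsto t).eventually (gt_mem_nhds htN)] with s hs
    exact hagree _ _ (Nat.ceil_le.2 hs.le) s (by linarith [Nat.le_ceil |s|])
  have h1 := hα N t (abs_lt.1 (by linarith))
  rw [show (fun t => α ⌈|t|⌉₊ t) t = α N t from hev.eq_of_nhds]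
  exact h1.congr_of_eventuallyEq hev

/-! ### Radial truncation -/

section Truncation

variable {X : Type*} [NormedAddCommGroup X] [NormedSpace ℝ X]

/-- The radial retraction onto the ball of radius `R`. -/
def trunc (R : ℝ) (u : X) : X := (R / max R ‖u‖) • u

theorem trunc_of_le {R : ℝ} (hR : 0 < R) {u : X} (hu : ‖u‖ ≤ R) : trunc R u = u := by
  rw [trunc, max_eq_left hu, div_self hR.ne', one_smul]

theorem norm_trunc_le {R : ℝ} (hR : 0 < R) (u : X) : ‖trunc R u‖ ≤ R := by
  have hm : 0 < max R ‖u‖ := lt_max_of_lt_left hR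
  rw [trunc, norm_smul, Real.norm_eq_abs, abs_of_pos (div_pos hR hm), div_mul_eq_mul_div,
    div_le_iff₀ hm]
  exact mul_le_mul_of_nonneg_left (le_max_right _ _) hR.le

/-- One `‖u - v‖` comes from moving the vector and one from the change of the scaling factor. -/
theorem norm_trunc_sub_le {R : ℝ} (hR : 0 < R) (u v : X) :
    ‖trunc R u - trunc R v‖ ≤ 2 * ‖u - v‖ := by
  have hu : 0 < max R ‖u‖ := lt_max_of_lt_left hR
  have hv : 0 < max R ‖v‖ := lt_max_of_lt_left hR
  have hd : trunc R u - trunc R v =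
      (R / max R ‖u‖) • (u - v) + (R / max R ‖u‖ - R / max R ‖v‖) • v := by
    rw [trunc, trunc, smul_sub, sub_smul]; abel
  have h1 : R / max R ‖u‖ ≤ 1 := (div_le_one hu).2 (le_max_left _ _)
  have h2 : |R / max R ‖u‖ - R / max R ‖v‖| * ‖v‖ ≤ ‖u - v‖ := by
    have h3 : R / max R ‖u‖ - R / max R ‖v‖ =
        (R / max R ‖u‖) * ((max R ‖v‖ - max R ‖u‖) / max R ‖v‖) := by
      field_simp
    have h4 : |max R ‖v‖ - max R ‖u‖| ≤ ‖u - v‖ := by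
      rw [max_comm R, max_comm R, norm_sub_rev]
      exact (abs_max_sub_max_le_abs _ _ _).trans (abs_norm_sub_norm_le v u)
    rw [h3, abs_mul, abs_of_pos (div_pos hR hu), abs_div, abs_of_pos hv]
    calc R / max R ‖u‖ * (|max R ‖v‖ - max R ‖u‖| / max R ‖v‖) * ‖v‖
        ≤ 1 * (|max R ‖v‖ - max R ‖u‖| / max R ‖v‖) * max R ‖v‖ := by
          gcongr
          exact le_max_right _ _
      _ = |max R ‖v‖ - max R ‖u‖| := by field_simp
      _ ≤ ‖u - v‖ := h4
  rw [hd]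
  refine (norm_add_le _ _).trans ?_
  rw [norm_smul, norm_smul, Real.norm_eq_abs, Real.norm_eq_abs, abs_of_pos (div_pos hR hu)]
  nlinarith [norm_nonneg (u - v)]

end Truncation

/-! ### The abstract semilinear Schrödinger equation -/

section Evolution

variable {X : Type*} [NormedAddCommGroup X] [InnerProductSpace ℂ X]

/-- For a continuous curve `w` such that `A w` is differentiable, `⟨w, A w⟩` is differentiable. -/
theorem hasDerivAt_re_inner_apply {A : X →L[ℂ] X}
    (hA : ∀ x y, inner ℂ (A x) y = inner ℂ x (A y)) {w : ℝ → X} {d : X} {t : ℝ}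
    (hw : ContinuousAt w t) (hd : HasDerivAt (fun s => A (w s)) d t) :
    HasDerivAt (fun s => (inner ℂ (w s) (A (w s))).re) (2 * (inner ℂ (w t) d).re) t := by
  rw [hasDerivAt_iff_tendsto_slope_zero] at hd ⊢
  have hw' : Filter.Tendsto (fun h => w (t + h)) (nhdsWithin 0 {0}ᶜ) (nhds (w t)) := by
    have h1 : Filter.Tendsto (fun h : ℝ => t + h) (nhds 0) (nhds t) := by
      simpa using (continuous_const_add t).tendsto 0
    exact (hw.tendsto.comp h1).mono_left nhdsWithin_le_nhds
  have h2 := Complex.continuous_re.continuousAt.tendsto.comp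
    ((hw'.add_const (w t)).inner hd (𝕜 := ℂ))
  have h3 : (inner ℂ (w t + w t) d).re = 2 * (inner ℂ (w t) d).re := by
    rw [inner_add_left, Complex.add_re]; ring
  rw [h3] at h2
  refine h2.congr fun h => ?_
  -- By symmetry the cross terms cancel, so the increment of `⟨w, A w⟩` is the real part of `⟨w(t+h)
  -- + w(t), A w(t+h) - A w(t)⟩`. Only `A w` is ever differentiated.
  have h4 : (inner ℂ (w t) (A (w (t + h)))).re = (inner ℂ (w (t + h)) (A (w t))).re := by
    rw [← hA, ← inner_conj_symm, Complex.conj_re]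
  simp only [Function.comp_apply, smul_eq_mul]
  rw [← Complex.coe_smul, inner_smul_right, Complex.re_ofReal_mul, inner_sub_right,
    inner_add_left, inner_add_left]
  simp only [Complex.add_re, Complex.sub_re]
  rw [h4]; ring

/-- Differentiability of a functional with gradient `G` along a curve that is only continuous,
but differentiable in the weaker norm. -/
theorem hasDerivAt_potential {A : X →L[ℂ] X} {G : X → X} {P : X → ℝ}
    (hP : ∀ M : ℝ, ∃ K : ℝ, 0 ≤ K ∧ ∀ a b, ‖a‖ ≤ M → ‖b‖ ≤ M →
      |P b - P a - (inner ℂ (G a) (A (b - a))).re| ≤ K * (inner ℂ (b - a) (A (b - a))).re)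
    {w : ℝ → X} {d : X} {t : ℝ}
    (hw : ContinuousAt w t) (hd : HasDerivAt (fun s => A (w s)) d t) :
    HasDerivAt (fun s => P (w s)) (inner ℂ (G (w t)) d).re t := by
  rw [hasDerivAt_iff_tendsto_slope_zero] at hd ⊢
  have hw' : Filter.Tendsto (fun h => w (t + h)) (nhdsWithin 0 {0}ᶜ) (nhds (w t)) := by
    have h1 : Filter.Tendsto (fun h : ℝ => t + h) (nhds 0) (nhds t) := by
      simpa using (continuous_const_add t).tendsto 0
    exact (hw.tendsto.comp h1).mono_left nhdsWithin_le_nhds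
  obtain ⟨K, hK0, hK⟩ := hP (‖w t‖ + 1)
  have hbd : ∀ᶠ h in nhdsWithin (0 : ℝ) {0}ᶜ, ‖w (t + h)‖ ≤ ‖w t‖ + 1 := by
    filter_upwards [hw'.norm.eventually (gt_mem_nhds (lt_add_one ‖w t‖))] with h hh
    exact hh.le
  have h2 := Complex.continuous_re.continuousAt.tendsto.comp
    ((tendsto_const_nhds (x := G (w t))).inner hd (𝕜 := ℂ))
  -- The remainder divided by `h` is a product of `‖w(t+h) - w(t)‖ → 0` with a convergent difference
  -- quotient of `A w`.
  have hz : Filter.Tendsto (fun h => K * (‖w (t + h) - w t‖ * ‖h⁻¹ • (A (w (t + h)) - A (w t))‖))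
      (nhdsWithin (0 : ℝ) {0}ᶜ) (nhds 0) := by
    have h3 := ((hw'.sub_const (w t)).norm.mul hd.norm).const_mul K
    simpa using h3
  have he : Filter.Tendsto (fun h => h⁻¹ • (P (w (t + h)) - P (w t)) -
      (inner ℂ (G (w t)) (h⁻¹ • (A (w (t + h)) - A (w t)))).re)
      (nhdsWithin (0 : ℝ) {0}ᶜ) (nhds 0) := by
    refine squeeze_zero_norm' ?_ hz
    filter_upwards [hbd] with h hh
    have h4 := hK (w t) (w (t + h)) (by linarith) hh
    have h5 : (inner ℂ (w (t + h) - w t) (A (w (t + h) - w t))).re ≤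
        ‖w (t + h) - w t‖ * ‖A (w (t + h) - w t)‖ :=
      (Complex.re_le_norm _).trans (norm_inner_le_norm _ _)
    have h6 : h⁻¹ • (P (w (t + h)) - P (w t)) -
        (inner ℂ (G (w t)) (h⁻¹ • (A (w (t + h)) - A (w t)))).re =
        h⁻¹ * (P (w (t + h)) - P (w t) - (inner ℂ (G (w t)) (A (w (t + h) - w t))).re) := by
      rw [← Complex.coe_smul, inner_smul_right, Complex.re_ofReal_mul, map_sub, smul_eq_mul]
      ring
    rw [h6, norm_mul, Real.norm_eq_abs (_ - _ - _), norm_smul, ← map_sub]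
    calc ‖h⁻¹‖ * _ ≤ ‖h⁻¹‖ * (K * (‖w (t + h) - w t‖ * ‖A (w (t + h) - w t)‖)) := by
          gcongr
          exact h4.trans (mul_le_mul_of_nonneg_left h5 hK0)
      _ = _ := by ring
  have h7 := he.add h2
  rw [zero_add] at h7
  refine h7.congr fun h => ?_
  simp only [Function.comp_apply]
  ring

variable [CompleteSpace X]

/-- Global solutions of `i (A u)' = u + A G(u)` for the truncated nonlinearity. -/
theorem exists_truncated_solution {A : X →L[ℂ] X} (hA : IsSelfAdjoint A)
    (hinj : Function.Injective A) {G : X → X} {R K : ℝ} (hR : 0 < R) (hK : 0 ≤ K)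
    (hG : ∀ u v, ‖u‖ ≤ R → ‖v‖ ≤ R → ‖G u - G v‖ ≤ K * ‖u - v‖) (u₀ : X) :
    ∃ u : ℝ → X, Continuous u ∧ u 0 = u₀ ∧
      (∀ t, HasDerivAt (fun s => A (u s)) (-Complex.I • (u t + A (G (trunc R (u t))))) t) ∧
      ∀ t, HasDerivAt (fun s => ‖u s‖ ^ 2)
        (2 * (inner ℂ (u t) (-Complex.I • G (trunc R (u t)))).re) t := by
  set F : X → X := fun u => G (trunc R u) with hF
  have hFlip : ∀ u v, ‖F u - F v‖ ≤ K * 2 * ‖u - v‖ := fun u v => by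
    refine (hG _ _ (norm_trunc_le hR u) (norm_trunc_le hR v)).trans ?_
    rw [mul_assoc]
    exact mul_le_mul_of_nonneg_left (norm_trunc_sub_le hR u v) hK
  have hFc : Continuous F :=
    (LipschitzWith.of_dist_le_mul (K := (K * 2).toNNReal) fun u v => by
      rw [dist_eq_norm, dist_eq_norm, Real.coe_toNNReal _ (by positivity)]
      exact hFlip u v).continuous
  have hFb : ∀ u, ‖F u‖ ≤ K * R + ‖G 0‖ := fun u => by
    have h1 := hG (trunc R u) 0 (norm_trunc_le hR u) (by simpa using hR.le)
    have h2 : F u = (G (trunc R u) - G 0) + G 0 := by simp [hF]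
    rw [h2]
    refine (norm_add_le _ _).trans (add_le_add_left (h1.trans ?_) _)
    rw [sub_zero]
    exact mul_le_mul_of_nonneg_left (norm_trunc_le hR u) hK
  have hUc := continuous_unitaryGroup hA hinj
  have hUc' : ∀ {f : ℝ → ℝ} {g : ℝ → X}, Continuous f → Continuous g →
      Continuous fun t => unitaryGroup A (f t) (g t) := fun {f g} hf hg =>
    Continuous.comp (g := fun q : ℝ × X => unitaryGroup A q.1 q.2) hUc (hf.prodMk hg)
  -- Interaction picture: for `α(t) = exp(itA⁻¹) u(t)` the unbounded term disappears. The field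
  -- inherits its bounds from `F` because the group is isometric.
  obtain ⟨α, hα0, hα⟩ := exists_hasDerivAt_of_lipschitz_of_bounded
    (f := fun t v => -Complex.I • unitaryGroup A (-t) (F (unitaryGroup A t v)))
    (K := (K * 2).toNNReal) (L := (K * R + ‖G 0‖).toNNReal)
    (fun t => LipschitzWith.of_dist_le_mul fun u v => by
      rw [dist_eq_norm, dist_eq_norm, ← smul_sub, ← map_sub, norm_smul, norm_neg, Complex.norm_I,
        one_mul, norm_unitaryGroup hA hinj, Real.coe_toNNReal _ (by positivity)]
      refine (hFlip _ _).trans (le_of_eq ?_)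
      rw [← map_sub, norm_unitaryGroup hA hinj])
    (fun x => by
      have h1 := hFc.comp (hUc' continuous_id (continuous_const (y := x)))
      exact (hUc' continuous_neg h1).const_smul (-Complex.I))
    (fun t x => by
      rw [norm_smul, norm_neg, Complex.norm_I, one_mul, norm_unitaryGroup hA hinj,
        Real.coe_toNNReal _ (by positivity)]
      exact hFb _) u₀
  have hαc : Continuous α := continuous_iff_continuousAt.2 fun t => (hα t).continuousAt
  refine ⟨fun t => unitaryGroup A t (α t), hUc' continuous_id hαc, ?_, fun t => ?_, fun t => ?_⟩
  · change unitaryGroup A 0 (α 0) = u₀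
    rw [hα0, unitaryGroup_zero hA hinj]
  · have h1 := hasDerivAt_unitaryGroup hA hinj (α t) t
    have h2 := hα t
    rw [hasDerivAt_iff_tendsto_slope_zero] at h1 h2 ⊢
    have ht : Filter.Tendsto (fun h : ℝ => t + h) (nhdsWithin 0 {0}ᶜ) (nhds t) := by
      have := (continuous_const_add t).tendsto (0 : ℝ)
      rw [add_zero] at this
      exact this.mono_left nhdsWithin_le_nhds
    -- Product rule by hand: `h1` differentiates the group at the fixed vector `α t`, and here
    -- `U(t+h)` is applied to the difference quotient of `α`. Joint strong continuity of the group
    -- gives the limit.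
    have h3 := (A.continuous.tendsto _).comp ((hUc.tendsto (t, _)).comp (ht.prodMk_nhds h2))
    have h4 := h1.add h3
    have h5 : -Complex.I • unitaryGroup A t (α t) + A (unitaryGroup A t
        (-Complex.I • unitaryGroup A (-t) (F (unitaryGroup A t (α t))))) =
        -Complex.I • (unitaryGroup A t (α t) + A (G (trunc R (unitaryGroup A t (α t))))) := by
      rw [map_smul, unitaryGroup_apply_neg hA hinj, map_smul, smul_add]
    simp only at h4
    rw [h5] at h4
    refine h4.congr fun h => ?_
    simp only [Function.comp_apply]
    rw [← Complex.coe_smul, ← Complex.coe_smul, ← Complex.coe_smul, map_smul, map_smul,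
      map_sub, map_sub, ← smul_add]
    congr 1
    abel
  -- Since `‖u(t)‖ = ‖α(t)‖` and `α` is differentiable in `X`, the squared norm is differentiable
  -- without differentiating `u` in `X`.
  · have h1 := hasDerivAt_re_inner_apply (A := ContinuousLinearMap.id ℂ X) (fun x y => rfl)
      (hα t).continuousAt (hα t)
    have h2 : (fun s => ‖unitaryGroup A s (α s)‖ ^ 2) =
        fun s => (inner ℂ (α s) (ContinuousLinearMap.id ℂ X (α s))).re := by
      funext s
      rw [norm_unitaryGroup hA hinj]
      exact (inner_self_eq_norm_sq (𝕜 := ℂ) (α s)).symm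
    rw [h2]
    have h3 : inner ℂ (unitaryGroup A t (α t)) (-Complex.I • F (unitaryGroup A t (α t))) =
        inner ℂ (α t) (-Complex.I • unitaryGroup A (-t) (F (unitaryGroup A t (α t)))) := by
      rw [← inner_unitaryGroup hA hinj t (α t), map_smul, unitaryGroup_apply_neg hA hinj]
    rw [show G (trunc R (unitaryGroup A t (α t))) = F (unitaryGroup A t (α t)) from rfl, h3]
    exact h1

end Evolution

/-- The times up to which `f ≤ R` holds form a set that is closed by continuity. It can be extended
to the right because the bound improves to `c < R`. -/
theorem forall_le_of_bootstrap {f : ℝ → ℝ} (hf : Continuous f) {R c : ℝ} (hcR : c < R)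
    (h0 : f 0 ≤ R) (h : ∀ T, 0 ≤ T → (∀ t ∈ Set.Icc 0 T, f t ≤ R) → f T ≤ c) :
    ∀ t, 0 ≤ t → f t ≤ c := by
  have key : ∀ T, 0 ≤ T → ∀ t ∈ Set.Icc 0 T, f t ≤ R := by
    intro T hT
    set s : Set ℝ := {t | ∀ τ ∈ Set.Icc 0 t, f τ ≤ R} with hs
    have hcl : IsClosed (s ∩ Set.Icc 0 T) := by
      have h1 : s ∩ Set.Icc 0 T =
          (⋂ τ : ℝ, ⋂ _ : 0 ≤ τ, ⋂ _ : R < f τ, Set.Iic τ) ∩ Set.Icc 0 T := by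
        ext t
        simp only [Set.mem_inter_iff, Set.mem_iInter, Set.mem_Iic, and_congr_left_iff]
        intro _
        constructor
        · intro ht τ hτ hR
          by_contra hlt
          exact absurd (ht τ ⟨hτ, (not_le.1 hlt).le⟩) (not_le.2 hR)
        · intro ht τ hτ
          by_contra hR
          have h2 := ht τ hτ.1 (not_le.1 hR)
          have h3 : τ = t := le_antisymm hτ.2 h2
          subst h3
          have hpos : 0 < τ := by
            rcases hτ.1.lt_or_eq with h4 | h4
            · exact h4
            · rw [← h4] at hR; exact absurd h0 hR
          have hev : ∀ᶠ y in nhdsWithin τ (Set.Iio τ), R < f y ∧ 0 < y :=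
            (((hf.tendsto τ).eventually (lt_mem_nhds (not_le.1 hR))).and
              (lt_mem_nhds hpos)).filter_mono nhdsWithin_le_nhds
          obtain ⟨y, ⟨hy1, hy2⟩, hy3⟩ := (hev.and self_mem_nhdsWithin).exists
          exact absurd (ht y hy2.le hy1) (not_le.2 hy3)
      rw [h1]
      exact (isClosed_iInter fun _ => isClosed_iInter fun _ => isClosed_iInter fun _ =>
        isClosed_Iic).inter isClosed_Icc
    have hsub : Set.Icc 0 T ⊆ s := by
      refine hcl.Icc_subset_of_forall_exists_gt ?_ ?_
      · intro τ hτ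
        rw [le_antisymm hτ.2 hτ.1]; exact h0
      · rintro x ⟨hx, hx0⟩ y hy
        have hfx : f x < R := (h x hx0.1 hx).trans_lt hcR
        obtain ⟨δ, hδ, hball⟩ := Metric.eventually_nhds_iff.1
          ((hf.tendsto x).eventually (gt_mem_nhds hfx))
        refine ⟨min y (x + δ / 2), fun τ hτ => ?_, ?_, min_le_left _ _⟩
        · by_cases hτx : τ ≤ x
          · exact hx τ ⟨hτ.1, hτx⟩
          · refine (hball ?_).le
            have h5 := hτ.2.trans (min_le_right _ _)
            rw [Real.dist_eq, abs_of_pos (by linarith)]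
            linarith
        · exact lt_min hy (by linarith)
    exact hsub ⟨hT, le_rfl⟩
  exact fun t ht => h t ht (key t ht)

theorem re_neg_I_mul (z : ℂ) : (-Complex.I * z).re = z.im := by simp

theorem re_neg_I_mul_inner_self {E : Type*} [NormedAddCommGroup E] [InnerProductSpace ℂ E]
    (x : E) : (-Complex.I * inner ℂ x x).re = 0 := by
  rw [re_neg_I_mul]
  exact inner_self_im (𝕜 := ℂ) x

/-! ### Uniqueness, conservation laws and small-data global existence. -/

section Wellposed

variable {X Y : Type*} [NormedAddCommGroup X] [InnerProductSpace ℂ X] [CompleteSpace X]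
  [NormedAddCommGroup Y] [InnerProductSpace ℂ Y] [CompleteSpace Y]

/-- The operator `J* J`, the inverse of the operator whose form domain is `X`. -/
def gram (J : X →L[ℂ] Y) : X →L[ℂ] X := (ContinuousLinearMap.adjoint J).comp J

theorem inner_gram_right (J : X →L[ℂ] Y) (x y : X) :
    inner ℂ x (gram J y) = inner ℂ (J x) (J y) :=
  ContinuousLinearMap.adjoint_inner_right J x (J y)

theorem inner_gram_left (J : X →L[ℂ] Y) (x y : X) :
    inner ℂ (gram J x) y = inner ℂ (J x) (J y) :=
  ContinuousLinearMap.adjoint_inner_left J y (J x)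

theorem inner_gram_symm (J : X →L[ℂ] Y) (x y : X) :
    inner ℂ (gram J x) y = inner ℂ x (gram J y) := by
  rw [inner_gram_left, inner_gram_right]

theorem isSelfAdjoint_gram (J : X →L[ℂ] Y) : IsSelfAdjoint (gram J) := by
  rw [ContinuousLinearMap.isSelfAdjoint_iff_isSymmetric]
  exact inner_gram_symm J

theorem re_inner_gram_self (J : X →L[ℂ] Y) (x : X) :
    (inner ℂ x (gram J x)).re = ‖J x‖ ^ 2 := by
  rw [inner_gram_right]
  exact inner_self_eq_norm_sq (𝕜 := ℂ) (J x)

theorem gram_injective {J : X →L[ℂ] Y} (hJ : Function.Injective J) :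
    Function.Injective (gram J) := by
  rw [injective_iff_map_eq_zero]
  intro x hx
  have h := re_inner_gram_self J x
  rw [hx, inner_zero_right] at h
  have h1 : J x = 0 := by simpa using h.symm
  exact hJ (h1.trans (map_zero J).symm)

theorem hasDerivAt_norm_sq_apply (J : X →L[ℂ] Y) {w : ℝ → X} {d : X} {t : ℝ}
    (hw : ContinuousAt w t) (hd : HasDerivAt (fun s => gram J (w s)) d t) :
    HasDerivAt (fun s => ‖J (w s)‖ ^ 2) (2 * (inner ℂ (w t) d).re) t := by
  have h := hasDerivAt_re_inner_apply (inner_gram_symm J) hw hd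
  simpa only [re_inner_gram_self] using h

/-- Uniqueness of bounded solutions of `i (J*J u)' = u + J*J G(u)`. -/
theorem eq_of_hasDerivAt_gram {J : X →L[ℂ] Y} (hJ : Function.Injective J) {G : X → X} {M K : ℝ}
    (hG : ∀ a b, ‖a‖ ≤ M → ‖b‖ ≤ M → ‖J (G a - G b)‖ ≤ K * ‖J (a - b)‖) {u v : ℝ → X}
    (hu : Continuous u) (hv : Continuous v) (hub : ∀ t, ‖u t‖ ≤ M) (hvb : ∀ t, ‖v t‖ ≤ M)
    (hud : ∀ t, HasDerivAt (fun s => gram J (u s)) (-Complex.I • (u t + gram J (G (u t)))) t)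
    (hvd : ∀ t, HasDerivAt (fun s => gram J (v s)) (-Complex.I • (v t + gram J (G (v t)))) t)
    (h0 : u 0 = v 0) : u = v := by
  set f : ℝ → ℝ := fun t => ‖J (u t - v t)‖ ^ 2 with hf
  set f' : ℝ → ℝ := fun t => 2 * (inner ℂ (u t - v t) (-Complex.I • (u t + gram J (G (u t))) -
    -Complex.I • (v t + gram J (G (v t))))).re with hf'
  have hfd : ∀ t, HasDerivAt f (f' t) t := fun t => by
    refine hasDerivAt_norm_sq_apply J (hu.sub hv).continuousAt ?_
    have := (hud t).fun_sub (hvd t)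
    simpa only [map_sub] using this
  have hbound : ∀ t, ‖f' t‖ ≤ 2 * K * ‖f t‖ := fun t => by
    -- The linear part contributes `-i‖u - v‖²`, which has no real part. What is left involves `u -
    -- v` only through `J`, so Grönwall closes in the weak norm.
    have h1 : (inner ℂ (u t - v t) (-Complex.I • (u t + gram J (G (u t))) -
        -Complex.I • (v t + gram J (G (v t))))).re =
        (-Complex.I * inner ℂ (J (u t - v t)) (J (G (u t) - G (v t)))).re := by
      rw [← smul_sub, add_sub_add_comm, ← map_sub, inner_smul_right, inner_add_right,
        inner_gram_right, mul_add, Complex.add_re, re_neg_I_mul_inner_self, zero_add]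
    have h2 : ‖f' t‖ ≤ 2 * (‖J (u t - v t)‖ * ‖J (G (u t) - G (v t))‖) := by
      simp only [hf']
      rw [h1, norm_mul, Real.norm_eq_abs, Real.norm_eq_abs, abs_two]
      refine mul_le_mul_of_nonneg_left ((Complex.abs_re_le_norm _).trans ?_) two_pos.le
      rw [norm_mul, norm_neg, Complex.norm_I, one_mul]
      exact norm_inner_le_norm _ _
    have h3 := mul_le_mul_of_nonneg_left (hG _ _ (hub t) (hvb t)) (norm_nonneg (J (u t - v t)))
    have h4 : ‖f t‖ = ‖J (u t - v t)‖ ^ 2 := by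
      rw [Real.norm_eq_abs, abs_of_nonneg (sq_nonneg _)]
    rw [h4]
    nlinarith
  have hf0 : f 0 = 0 := by simp [hf, h0]
  have hfc : Continuous f := continuous_iff_continuousAt.2 fun t => (hfd t).continuousAt
  have hpos : ∀ t, 0 ≤ t → f t = 0 := fun t ht =>
    eq_zero_of_abs_deriv_le_mul_abs_self_of_eq_zero_right (f := f) (f' := f') (K := 2 * K)
      (a := 0) (b := t) hfc.continuousOn (fun x _ => (hfd x).hasDerivWithinAt) hf0
      (fun x _ => hbound x) t ⟨ht, le_rfl⟩
  have hneg : ∀ t, 0 ≤ t → f (-t) = 0 := fun t ht => by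
    refine eq_zero_of_abs_deriv_le_mul_abs_self_of_eq_zero_right (f := fun s => f (-s))
      (f' := fun s => -f' (-s)) (K := 2 * K) (a := 0) (b := t)
      (hfc.comp continuous_neg).continuousOn (fun x _ => ?_) (by simpa using hf0)
      (fun x _ => by rw [norm_neg]; exact hbound (-x)) t ⟨ht, le_rfl⟩
    have h5 := (hfd (-x)).scomp x (hasDerivAt_neg x)
    simpa [Function.comp_def] using h5.hasDerivWithinAt
  funext t
  have ht : f t = 0 := by
    rcases le_total 0 t with h | h
    · exact hpos t h
    · have := hneg (-t) (by linarith)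
      rwa [neg_neg] at this
  have h6 : J (u t - v t) = 0 := by simpa [hf] using ht
  exact sub_eq_zero.1 (hJ (h6.trans (map_zero J).symm))

/-- Global existence for small data from conservation of energy and mass. -/
theorem exists_global_of_coercive {J : X →L[ℂ] Y} (hJ : Function.Injective J) {G : X → X}
    {P : X → ℝ} {R C κ K : ℝ} (hR : 0 < R) (hC : 0 < C) (hK : 0 ≤ K)
    (hG : ∀ u v, ‖u‖ ≤ R → ‖v‖ ≤ R → ‖G u - G v‖ ≤ K * ‖u - v‖)
    (hGr : ∀ u, (inner ℂ (J u) (J (G u))).im = 0)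
    (hP : ∀ M : ℝ, ∃ K : ℝ, 0 ≤ K ∧ ∀ a b, ‖a‖ ≤ M → ‖b‖ ≤ M →
      |P b - P a - (inner ℂ (J (G a)) (J (b - a))).re| ≤ K * ‖J (b - a)‖ ^ 2)
    (hco : ∀ u, ‖u‖ ≤ R → C⁻¹ * ‖u‖ ^ 2 ≤ 1 / 2 * ‖u‖ ^ 2 + P u + κ * ‖J u‖ ^ 2 ∧
      1 / 2 * ‖u‖ ^ 2 + P u + κ * ‖J u‖ ^ 2 ≤ C * ‖u‖ ^ 2)
    (u₀ : X) (hu₀ : ‖u₀‖ ≤ R) (hCu₀ : C * ‖u₀‖ < R) :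
    ∃ u : ℝ → X, Continuous u ∧ u 0 = u₀ ∧ (∀ t, ‖u t‖ ≤ C * ‖u₀‖) ∧
      ∀ t, HasDerivAt (fun s => gram J (u s)) (-Complex.I • (u t + gram J (G (u t)))) t := by
  obtain ⟨u, huc, hu0, hud, hun⟩ := exists_truncated_solution (isSelfAdjoint_gram J)
    (gram_injective hJ) hR hK hG u₀
  set E : ℝ → ℝ := fun t => 1 / 2 * ‖u t‖ ^ 2 + P (u t) + κ * ‖J (u t)‖ ^ 2 with hE
  have hEd : ∀ t, ‖u t‖ ≤ R → HasDerivAt E 0 t := by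
    intro t ht
    have h1 := hun t
    have h2 := hud t
    rw [trunc_of_le hR ht] at h1 h2
    have h3 := hasDerivAt_potential (A := gram J) (G := G) (P := P)
      (by simpa only [re_inner_gram_self, inner_gram_right _ (G _)] using hP) huc.continuousAt h2
    have h4 := hasDerivAt_norm_sq_apply J huc.continuousAt h2
    have h5 := ((h1.const_mul (1 / 2)).add h3).add (h4.const_mul κ)
    -- Conservation of mass: `‖u‖²` and, by `hGr`, `⟨J u, J G(u)⟩` are real.
    have e1 : (inner ℂ (u t) (-Complex.I • (u t + gram J (G (u t))))).re = 0 := by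
      rw [inner_smul_right, inner_add_right, mul_add, Complex.add_re, re_neg_I_mul_inner_self,
        inner_gram_right]
      simp [hGr]
    -- The term `-i‖J G(u)‖²` drops out, and the remaining one cancels the derivative of `½‖u‖²`:
    -- conservation of energy.
    have e2 : (inner ℂ (G (u t)) (-Complex.I • (u t + gram J (G (u t))))).re =
        -(inner ℂ (u t) (-Complex.I • G (u t))).re := by
      rw [inner_smul_right, inner_add_right, mul_add, Complex.add_re, inner_gram_right,
        re_neg_I_mul_inner_self, add_zero, inner_smul_right, ← inner_conj_symm (G (u t)) (u t),
        re_neg_I_mul, re_neg_I_mul, Complex.conj_im]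
    rw [e1, e2] at h5
    have e3 : 1 / 2 * (2 * (inner ℂ (u t) (-Complex.I • G (u t))).re) +
        -(inner ℂ (u t) (-Complex.I • G (u t))).re + κ * (2 * 0) = 0 := by ring
    rw [e3] at h5
    exact h5
  have hcons : ∀ T, (∀ t ∈ Set.uIcc 0 T, ‖u t‖ ≤ R) → E T = E 0 := by
    intro T hT
    have h := Convex.norm_image_sub_le_of_norm_hasDerivWithin_le (f := E) (f' := fun _ => 0)
      (C := 0) (fun t ht => (hEd t (hT t ht)).hasDerivWithinAt) (fun _ _ => by simp)
      (convex_uIcc 0 T) Set.left_mem_uIcc Set.right_mem_uIcc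
    rw [zero_mul, norm_le_zero_iff, sub_eq_zero] at h
    exact h
  have hstep : ∀ T, (∀ t ∈ Set.uIcc 0 T, ‖u t‖ ≤ R) → ‖u T‖ ≤ C * ‖u₀‖ := by
    intro T hT
    -- The lower coercivity bound at `T`, conservation, and the upper bound at time `0` give `‖u T‖²
    -- ≤ C² ‖u₀‖²`.
    have h1 := (hco (u T) (hT T Set.right_mem_uIcc)).1
    have h2 := (hco u₀ hu₀).2
    have h3 := hcons T hT
    simp only [hE, hu0] at h3
    rw [h3] at h1
    have h4 : C⁻¹ * ‖u T‖ ^ 2 ≤ C * ‖u₀‖ ^ 2 := h1.trans h2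
    rw [inv_mul_le_iff₀ hC] at h4
    refine abs_le_of_sq_le_sq' ?_ (by positivity) |>.2
    calc ‖u T‖ ^ 2 ≤ C * (C * ‖u₀‖ ^ 2) := h4
      _ = (C * ‖u₀‖) ^ 2 := by ring
  have hbd : ∀ t, ‖u t‖ ≤ C * ‖u₀‖ := by
    intro t
    rcases le_total 0 t with ht | ht
    · refine forall_le_of_bootstrap huc.norm hCu₀ (by rw [hu0]; exact hu₀) (fun T hT h => ?_) t ht
      exact hstep T (by rwa [Set.uIcc_of_le hT])
    · have := forall_le_of_bootstrap (f := fun t => ‖u (-t)‖) (huc.comp continuous_neg).norm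
        hCu₀ (by simpa [hu0] using hu₀) (fun T hT h => ?_) (-t) (by linarith)
      · simpa using this
      · refine hstep (-T) fun τ hτ => ?_
        rw [Set.uIcc_of_ge (by linarith)] at hτ
        simpa using h (-τ) ⟨by linarith [hτ.2], by linarith [hτ.1]⟩
  refine ⟨u, huc, hu0, hbd, fun t => ?_⟩
  have := hud t
  rwa [trunc_of_le hR ((hbd t).trans hCu₀.le)] at this

end Wellposed

/-! ### Identification of `Ĥ⁻¹` with `Ĥ¹` -/

theorem integral_mul_eq_inner (f g : L2) : ∫ x, f x * g x = inner ℂ (star g) f := by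
  rw [MeasureTheory.L2.inner_def]
  refine integral_congr_ae ?_
  filter_upwards [coeFn_star_L2 g] with x hx
  rw [hx]
  simp

theorem integrable_mul_L2 (f g : L2) : Integrable fun x => f x * g x :=
  (Lp.memLp f).integrable_mul (Lp.memLp g)

/-- The Riesz isomorphism `Ĥ¹ → Ĥ⁻¹` for the bilinear pairing. -/
def rieszMap : Hhat1 →L[ℂ] HhatNeg1 :=
  ((ContinuousLinearMap.mul ℂ ℂ).lpPairing (volume : Measure ℝ) 2 2).bilinearComp fn fn +
  ((ContinuousLinearMap.mul ℂ ℂ).lpPairing (volume : Measure ℝ) 2 2).bilinearComp dx dx +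
  ((ContinuousLinearMap.mul ℂ ℂ).lpPairing (volume : Measure ℝ) 2 2).bilinearComp wt wt

theorem rieszMap_apply (u φ : Hhat1) : rieszMap u φ =
    (∫ x, fn u x * fn φ x) + (∫ x, dx u x * dx φ x) + ∫ x, wt u x * wt φ x := by
  have h : ∀ f g : L2, (ContinuousLinearMap.mul ℂ ℂ).lpPairing (volume : Measure ℝ) 2 2 f g =
      ∫ x, f x * g x := fun f g => ContinuousLinearMap.lpPairing_eq_integral _ _ _
  rw [← h, ← h, ← h]
  rfl

theorem rieszMap_eq_inner (u φ : Hhat1) : rieszMap u φ = inner ℂ (conj φ) u := by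
  rw [rieszMap_apply, inner_Hhat1, integral_mul_eq_inner, integral_mul_eq_inner,
    integral_mul_eq_inner]
  rfl

/-- The dual pairing is bilinear while the inner product is conjugate-linear in its first slot.
Precomposing with conjugation, an isometry of `Ĥ¹`, reconciles them and makes `rieszMap` an
isometric isomorphism. -/
theorem rieszMap_eq_toDual (u : Hhat1) :
    rieszMap u = InnerProductSpace.toDual ℂ Hhat1 (conj u) := by
  ext φ
  rw [InnerProductSpace.toDual_apply_apply, rieszMap_apply, inner_Hhat1, fn_conj_eq, dx_conj_eq,
    wt_conj_eq, ← integral_mul_eq_inner, ← integral_mul_eq_inner, ← integral_mul_eq_inner]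
  simp only [mul_comm]

/-- `rieszMap` as an isometric isomorphism. -/
def rieszEquiv : Hhat1 ≃ₗᵢ[ℂ] HhatNeg1 :=
  LinearIsometryEquiv.ofSurjective
    (⟨(rieszMap : Hhat1 →ₗ[ℂ] HhatNeg1), fun u => by
      change ‖rieszMap u‖ = ‖u‖
      rw [rieszMap_eq_toDual, LinearIsometryEquiv.norm_map, norm_conj_Hhat1]⟩ :
        Hhat1 →ₗᵢ[ℂ] HhatNeg1)
    (fun ℓ => ⟨conj ((InnerProductSpace.toDual ℂ Hhat1).symm ℓ), by
      change rieszMap _ = ℓ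
      rw [rieszMap_eq_toDual, conj_conj_Hhat1, LinearIsometryEquiv.apply_symm_apply]⟩)

theorem rieszEquiv_apply (u : Hhat1) : rieszEquiv u = rieszMap u := rfl

theorem toHhatNeg1_eq_rieszMap (u : Hhat1) : toHhatNeg1 u = rieszMap (gram fn u) := by
  ext φ
  rw [toHhatNeg1_apply, rieszMap_eq_inner, inner_gram_right, integral_mul_eq_inner]
  rfl

theorem fn_injective : Function.Injective fn := fun _ _ h => Hhat1.ext_fn h

/-! ### The nonlinearity -/

/-- The function `|u|^{2k} u`. -/
def absPowMul : ℕ → Hhat1 → Hhat1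
  | 0, u => u
  | k + 1, u => mul (mul u (conj u)) (absPowMul k u)

theorem fn_absPowMul (k : ℕ) (u : Hhat1) :
    ∀ᵐ x : ℝ, fn (absPowMul k u) x = ((‖fn u x‖ ^ (2 * k) : ℝ) : ℂ) * fn u x := by
  induction k with
  | zero => exact Filter.Eventually.of_forall fun x => by simp [absPowMul]
  | succ k ih =>
    filter_upwards [ih, fn_mul (mul u (conj u)) (absPowMul k u), fn_mul u (conj u), fn_conj u]
      with x h1 h2 h3 h4
    rw [absPowMul, h2, h3, h4, h1, Complex.mul_conj']
    push_cast
    ring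

theorem norm_absPowMul_bound (k : ℕ) {M : ℝ} (hM : 0 ≤ M) :
    ∃ B : ℝ, 0 ≤ B ∧ ∀ u : Hhat1, ‖u‖ ≤ M → ‖absPowMul k u‖ ≤ B := by
  induction k with
  | zero => exact ⟨M, hM, fun u hu => hu⟩
  | succ k ih =>
    obtain ⟨B, hB, h⟩ := ih
    refine ⟨8 * (8 * M * M) * B, by positivity, fun u hu => ?_⟩
    refine (norm_mul_Hhat1_le _ _).trans ?_
    have h1 : ‖mul u (conj u)‖ ≤ 8 * M * M := by
      refine (norm_mul_Hhat1_le _ _).trans ?_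
      rw [norm_conj_Hhat1]
      gcongr
    have h2 := h u hu
    gcongr

/-- `|u|^{2k} u` is Lipschitz on bounded sets for each seminorm compatible with products. -/
theorem absPowMul_lipschitz (ν : Seminorm ℂ Hhat1) {c : ℝ} (hc : 0 ≤ c)
    (hmul : ∀ a b, ν (mul a b) ≤ c * ‖a‖ * ν b) (hconj : ∀ a, ν (conj a) = ν a) (k : ℕ)
    {M : ℝ} (hM : 0 ≤ M) : ∃ K : ℝ, 0 ≤ K ∧ ∀ u v : Hhat1, ‖u‖ ≤ M → ‖v‖ ≤ M →
      ν (absPowMul k u - absPowMul k v) ≤ K * ν (u - v) := by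
  induction k with
  | zero => exact ⟨1, one_pos.le, fun u v _ _ => by rw [one_mul]; rfl⟩
  | succ k ih =>
    obtain ⟨K, hK, h⟩ := ih
    obtain ⟨B, hB, hb⟩ := norm_absPowMul_bound k hM
    refine ⟨c * (8 * M * M) * K + c * B * (c * M + c * M), by positivity, fun u v hu hv => ?_⟩
    -- The telescoping is arranged so that every product has one factor bounded in `Ĥ¹` and one
    -- factor containing a difference, which is the one measured by `ν`.
    have hd : absPowMul (k + 1) u - absPowMul (k + 1) v =
        mul (mul u (conj u)) (absPowMul k u - absPowMul k v) +
        mul (absPowMul k v) (mul (conj u) (u - v) + mul v (conj (u - v))) := by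
      have e1 : mul (conj u) (u - v) + mul v (conj (u - v)) =
          mul u (conj u) - mul v (conj v) := by
        rw [mul_sub_Hhat1, conj_sub, mul_sub_Hhat1, mul_comm_Hhat1 (conj u) u,
          mul_comm_Hhat1 (conj u) v]
        abel
      rw [e1, mul_sub_Hhat1, mul_comm_Hhat1 (absPowMul k v), sub_mul_Hhat1]
      simp only [absPowMul]
      abel
    have hν := apply_nonneg ν (u - v)
    have h1 : ν (mul (mul u (conj u)) (absPowMul k u - absPowMul k v)) ≤
        c * (8 * M * M) * (K * ν (u - v)) := by
      refine (hmul _ _).trans ?_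
      have h3 : ‖mul u (conj u)‖ ≤ 8 * M * M := by
        refine (norm_mul_Hhat1_le _ _).trans ?_
        rw [norm_conj_Hhat1]
        gcongr
      have h4 := h u v hu hv
      have h5 := apply_nonneg ν (absPowMul k u - absPowMul k v)
      gcongr
    have h2 : ν (mul (absPowMul k v) (mul (conj u) (u - v) + mul v (conj (u - v)))) ≤
        c * B * (c * M * ν (u - v) + c * M * ν (u - v)) := by
      refine (hmul _ _).trans ?_
      have h3 : ν (mul (conj u) (u - v) + mul v (conj (u - v))) ≤
          c * M * ν (u - v) + c * M * ν (u - v) := by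
        refine (map_add_le_add ν _ _).trans (add_le_add ?_ ?_)
        · refine (hmul _ _).trans ?_
          rw [norm_conj_Hhat1]
          gcongr
        · refine (hmul _ _).trans ?_
          rw [hconj]
          gcongr
      have h4 := hb v hv
      have h5 := apply_nonneg ν (mul (conj u) (u - v) + mul v (conj (u - v)))
      gcongr
    rw [hd]
    refine (map_add_le_add ν _ _).trans ((add_le_add h1 h2).trans (le_of_eq ?_))
    ring

/-- The nonlinearity `V u - 2 u + σ |u|^{2p} u`. -/
def nonlin (p : ℕ) (σ : ℝ) (V u : Hhat1) : Hhat1 :=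
  mul V u - (2 : ℂ) • u + (σ : ℂ) • absPowMul p u

theorem fn_nonlin (p : ℕ) (σ : ℝ) (V u : Hhat1) : ∀ᵐ x : ℝ, fn (nonlin p σ V u) x =
    (fn V x - 2 + σ * ((‖fn u x‖ ^ (2 * p) : ℝ) : ℂ)) * fn u x := by
  filter_upwards [fn_add_ae (mul V u - (2 : ℂ) • u) ((σ : ℂ) • absPowMul p u),
    fn_sub_ae (mul V u) ((2 : ℂ) • u), fn_smul_ae 2 u, fn_smul_ae σ (absPowMul p u),
    fn_absPowMul p u, fn_mul V u] with x h1 h2 h3 h4 h5 h6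
  rw [nonlin, h1, h2, h3, h4, h5, h6]
  ring

theorem nonlin_lipschitz (ν : Seminorm ℂ Hhat1) {c : ℝ} (hc : 0 ≤ c)
    (hmul : ∀ a b, ν (mul a b) ≤ c * ‖a‖ * ν b) (hconj : ∀ a, ν (conj a) = ν a) (p : ℕ)
    (σ : ℝ) (V : Hhat1) {M : ℝ} (hM : 0 ≤ M) : ∃ K : ℝ, 0 ≤ K ∧ ∀ u v : Hhat1, ‖u‖ ≤ M →
      ‖v‖ ≤ M → ν (nonlin p σ V u - nonlin p σ V v) ≤ K * ν (u - v) := by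
  obtain ⟨K, hK, h⟩ := absPowMul_lipschitz ν hc hmul hconj p hM
  refine ⟨c * ‖V‖ + 2 + |σ| * K, by positivity, fun u v hu hv => ?_⟩
  have hd : nonlin p σ V u - nonlin p σ V v = mul V (u - v) + (-(2 : ℂ)) • (u - v) +
      (σ : ℂ) • (absPowMul p u - absPowMul p v) := by
    rw [nonlin, nonlin, mul_sub_Hhat1, smul_sub, smul_sub, neg_smul, neg_smul]
    abel
  rw [hd]
  refine (map_add_le_add ν _ _).trans ?_
  refine (add_le_add_left (map_add_le_add ν _ _) _).trans ?_
  rw [map_smul_eq_mul, map_smul_eq_mul, norm_neg, Complex.norm_real, Real.norm_eq_abs,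
    show ‖(2 : ℂ)‖ = 2 by simp]
  have h1 := hmul V (u - v)
  have h2 := mul_le_mul_of_nonneg_left (h u v hu hv) (abs_nonneg σ)
  linarith

/-- Used for existence, where the ODE is solved in `Ĥ¹`. -/
theorem nonlin_lipschitz_norm (p : ℕ) (σ : ℝ) (V : Hhat1) {M : ℝ} (hM : 0 ≤ M) :
    ∃ K : ℝ, 0 ≤ K ∧ ∀ u v : Hhat1, ‖u‖ ≤ M → ‖v‖ ≤ M →
      ‖nonlin p σ V u - nonlin p σ V v‖ ≤ K * ‖u - v‖ :=
  nonlin_lipschitz (normSeminorm ℂ Hhat1) (c := 8) (by norm_num) norm_mul_Hhat1_le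
    norm_conj_Hhat1 p σ V hM

/-- Used for uniqueness, which is proved in `L²`; the factors without a difference are estimated in
`L^∞`. -/
theorem nonlin_lipschitz_fn (p : ℕ) (σ : ℝ) (V : Hhat1) {M : ℝ} (hM : 0 ≤ M) :
    ∃ K : ℝ, 0 ≤ K ∧ ∀ u v : Hhat1, ‖u‖ ≤ M → ‖v‖ ≤ M →
      ‖fn (nonlin p σ V u - nonlin p σ V v)‖ ≤ K * ‖fn (u - v)‖ :=
  nonlin_lipschitz ((normSeminorm ℂ L2).comp (fn : Hhat1 →ₗ[ℂ] L2)) (c := 2) (by norm_num)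
    (fun a b => by
      change ‖fn (mul a b)‖ ≤ 2 * ‖a‖ * ‖fn b‖
      rw [mul_comm_Hhat1, fn_mul_eq]
      exact norm_mulL2_le _ _) norm_fn_conj p σ V hM

theorem continuous_nonlin (p : ℕ) (σ : ℝ) (V : Hhat1) : Continuous (nonlin p σ V) := by
  rw [continuous_iff_continuousAt]
  intro u
  obtain ⟨K, -, h⟩ := nonlin_lipschitz_norm p σ V (M := ‖u‖ + 1) (by positivity)
  rw [ContinuousAt, tendsto_iff_norm_sub_tendsto_zero]
  have h1 : Filter.Tendsto (fun v => K * ‖v - u‖) (nhds u) (nhds 0) := by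
    have := (((continuous_id.sub continuous_const).norm).const_mul K).tendsto (x := u)
      (f := fun v => K * ‖v - u‖)
    simpa using this
  refine squeeze_zero' (Filter.Eventually.of_forall fun _ => norm_nonneg _) ?_ h1
  filter_upwards [(continuous_norm.tendsto u).eventually (gt_mem_nhds (lt_add_one ‖u‖))]
    with v hv
  exact h v u hv.le (by linarith)

/-- The right-hand side of the equation, tested against `φ`. -/
theorem rhs_eq_rieszMap (p : ℕ) (σ : ℝ) {V : ℝ → ℝ} {V' : Hhat1}
    (hV : ∀ᵐ x : ℝ, fn V' x = (V x : ℂ)) (u φ : Hhat1) :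
    (∫ x, dx u x * dx φ x) + (∫ x : ℝ, (x : ℂ) ^ 2 * fn u x * fn φ x) +
      (∫ x, (V x : ℂ) * fn u x * fn φ x) +
      (σ : ℂ) * ∫ x, ((‖fn u x‖ ^ (2 * p) : ℝ) : ℂ) * fn u x * fn φ x =
    rieszMap (u + gram fn (nonlin p σ V' u)) φ := by
  -- Replacing `x²` by `⟨x⟩² - 1` costs one copy of `u`, and the `L²` part of `rieszMap` another.
  -- The term `-2u` in `nonlin` compensates for both.
  have h1 : ∫ x : ℝ, (x : ℂ) ^ 2 * fn u x * fn φ x =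
      (∫ x, wt u x * wt φ x) - ∫ x, fn u x * fn φ x := by
    rw [← integral_sub (integrable_mul_L2 _ _) (integrable_mul_L2 _ _)]
    refine integral_congr_ae ?_
    filter_upwards [wt_ae_eq u, wt_ae_eq φ] with x h2 h3
    have h4 : (bracket x : ℂ) * (bracket x : ℂ) = 1 + (x : ℂ) ^ 2 := by
      rw [← Complex.ofReal_mul, bracket, Real.mul_self_sqrt (by positivity)]
      push_cast; rfl
    rw [h2, h3]
    linear_combination -(fn u x * fn φ x) * h4
  have h2 : ∫ x, (V x : ℂ) * fn u x * fn φ x = toHhatNeg1 (mul V' u) φ := by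
    rw [toHhatNeg1_apply]
    refine integral_congr_ae ?_
    filter_upwards [hV, fn_mul V' u] with x h3 h4
    rw [h4, h3]
  have h3 : ∫ x, ((‖fn u x‖ ^ (2 * p) : ℝ) : ℂ) * fn u x * fn φ x =
      toHhatNeg1 (absPowMul p u) φ := by
    rw [toHhatNeg1_apply]
    refine integral_congr_ae ?_
    filter_upwards [fn_absPowMul p u] with x h4
    rw [h4]
  have h4 : toHhatNeg1 (nonlin p σ V' u) φ = toHhatNeg1 (mul V' u) φ - 2 * toHhatNeg1 u φ +
      σ * toHhatNeg1 (absPowMul p u) φ := by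
    rw [nonlin, map_add, map_sub, map_smul, map_smul]
    rfl
  rw [map_add, ← toHhatNeg1_eq_rieszMap, add_apply, h4, h1, h2, h3, rieszMap_apply,
    toHhatNeg1_apply u]
  ring

instance : ContinuousSMul ℝ HhatNeg1 := ⟨by
  have h : (fun q : ℝ × HhatNeg1 => q.1 • q.2) = fun q => (q.1 : ℂ) • q.2 := by
    funext q
    ext φ
    simp
  rw [h]
  exact (Complex.continuous_ofReal.comp continuous_fst).smul continuous_snd⟩

theorem hasDerivAt_clm_comp {E F : Type*} [NormedAddCommGroup E] [NormedSpace ℝ E]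
    [NormedAddCommGroup F] [NormedSpace ℝ F] (L : E →L[ℝ] F) {f : ℝ → E} {f' : E} {t : ℝ}
    (h : HasDerivAt f f' t) : HasDerivAt (fun s => L (f s)) (L f') t :=
  L.hasFDerivAt.comp_hasDerivAt t h

theorem deriv_eq_of_hasDerivAt {F : Type*} [NormedAddCommGroup F] [NormedSpace ℝ F] {f : ℝ → F}
    {f' : F} {t : ℝ} (h : HasDerivAt f f' t) : deriv f t = f' := h.deriv

theorem contDiff_one_of_hasDerivAt {F : Type*} [NormedAddCommGroup F] [NormedSpace ℝ F]
    {f f' : ℝ → F} (h : ∀ t, HasDerivAt f (f' t) t) (hf : Continuous f') : ContDiff ℝ 1 f := by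
  rw [contDiff_one_iff_deriv]
  refine ⟨fun t => (h t).differentiableAt, ?_⟩
  rwa [show deriv f = f' from funext fun t => (h t).deriv]

/-- The equation in `Ĥ⁻¹`, rewritten as an equation in `Ĥ¹`. -/
theorem isGlobalSolution_iff (p : ℕ) (σ : ℝ) {V : ℝ → ℝ} {V' : Hhat1}
    (hV : ∀ᵐ x : ℝ, fn V' x = (V x : ℂ)) (u₀ : Hhat1) (u : ℝ →ᵇ Hhat1) :
    IsGlobalSolution p σ V u₀ u ↔ u 0 = u₀ ∧ ∀ t, HasDerivAt (fun s => gram fn (u s))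
      (-Complex.I • (u t + gram fn (nonlin p σ V' (u t)))) t := by
  have hfun : (fun t => toHhatNeg1 (u t)) = fun t => rieszMap (gram fn (u t)) :=
    funext fun t => toHhatNeg1_eq_rieszMap _
  constructor
  · intro h
    refine ⟨h.initial, fun t => ?_⟩
    have h1 : HasDerivAt (fun s => toHhatNeg1 (u s)) (deriv (fun s => toHhatNeg1 (u s)) t) t :=
      ((h.contDiff.differentiable (by simp)) t).hasDerivAt
    have h2 : deriv (fun s => toHhatNeg1 (u s)) t =
        rieszEquiv (-Complex.I • (u t + gram fn (nonlin p σ V' (u t)))) := by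
      ext φ
      have h3 := h.equation t φ
      rw [rhs_eq_rieszMap p σ hV] at h3
      rw [rieszEquiv_apply, map_smul, smul_apply, ← h3, smul_eq_mul, ← mul_assoc]
      simp
    rw [h2, hfun] at h1
    set S : HhatNeg1 →L[ℂ] Hhat1 := rieszEquiv.symm.toContinuousLinearEquiv.toContinuousLinearMap
    have h4 := hasDerivAt_clm_comp (E := HhatNeg1) (S.restrictScalars ℝ) h1
    have h5 : ∀ w : Hhat1, S.restrictScalars ℝ (rieszEquiv w) = w :=
      fun w => rieszEquiv.symm_apply_apply w
    rw [h5] at h4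
    refine h4.congr_of_eventuallyEq (Filter.Eventually.of_forall fun s => ?_)
    exact (h5 _).symm
  · rintro ⟨h0, h⟩
    have hd : ∀ t, HasDerivAt (fun s => toHhatNeg1 (u s))
        (rieszMap (-Complex.I • (u t + gram fn (nonlin p σ V' (u t))))) t := fun t => by
      rw [hfun]
      exact hasDerivAt_clm_comp (F := HhatNeg1) (rieszMap.restrictScalars ℝ) (h t)
    have hde : deriv (fun s => toHhatNeg1 (u s)) =
        fun t => rieszMap (-Complex.I • (u t + gram fn (nonlin p σ V' (u t)))) :=
      funext fun t => deriv_eq_of_hasDerivAt (F := HhatNeg1) (hd t)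
    refine ⟨h0, ?_, fun t φ => ?_⟩
    -- `C¹` regularity in `Ĥ⁻¹` follows from the equation, whose right-hand side is continuous in
    -- time.
    · have hn : Continuous fun t => nonlin p σ V' (u t) :=
        (continuous_nonlin p σ V').comp u.continuous
      have hg : Continuous fun t => gram fn (nonlin p σ V' (u t)) :=
        (gram fn).continuous.comp hn
      have hs : Continuous fun t => -Complex.I • (u t + gram fn (nonlin p σ V' (u t))) :=
        (u.continuous.add hg).const_smul (-Complex.I)
      exact contDiff_one_of_hasDerivAt (F := HhatNeg1) hd (rieszMap.continuous.comp hs)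
    · rw [hde, rhs_eq_rieszMap p σ hV]
      simp only [map_smul, smul_apply, smul_eq_mul]
      rw [← mul_assoc]
      simp

/-! ### The energy -/

theorem pow_taylor_bound (q : ℕ) {S : ℝ} (hS : 0 ≤ S) :
    ∃ K : ℝ, 0 ≤ K ∧ ∀ r s : ℝ, 0 ≤ r → r ≤ S → 0 ≤ s → s ≤ S →
      |r ^ (q + 1) - s ^ (q + 1)| ≤ K * |r - s| ∧
      |r ^ (q + 1) - s ^ (q + 1) - (q + 1) * s ^ q * (r - s)| ≤ K * |r - s| ^ 2 := by
  induction q with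
  | zero => exact ⟨1, one_pos.le, fun r s _ _ _ _ => ⟨by simp, by simp; positivity⟩⟩
  | succ q ih =>
    obtain ⟨K, hK, h⟩ := ih
    refine ⟨S ^ (q + 1) + S * K + K, by positivity, fun r s hr hrS hs hsS => ?_⟩
    obtain ⟨h1, h2⟩ := h r s hr hrS hs hsS
    have hd := abs_nonneg (r - s)
    constructor
    · have e : r ^ (q + 1 + 1) - s ^ (q + 1 + 1) =
          r ^ (q + 1) * (r - s) + s * (r ^ (q + 1) - s ^ (q + 1)) := by ring
      rw [e]
      refine (abs_add_le _ _).trans ?_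
      rw [abs_mul, abs_mul, abs_of_nonneg hs, abs_of_nonneg (pow_nonneg hr _)]
      have h3 : r ^ (q + 1) * |r - s| ≤ S ^ (q + 1) * |r - s| := by gcongr
      have h4 : s * |r ^ (q + 1) - s ^ (q + 1)| ≤ S * (K * |r - s|) := by gcongr
      nlinarith [mul_nonneg hK hd]
    · have e : r ^ (q + 1 + 1) - s ^ (q + 1 + 1) -
          ((q + 1 : ℕ) + 1) * s ^ (q + 1) * (r - s) =
          s * (r ^ (q + 1) - s ^ (q + 1) - (q + 1) * s ^ q * (r - s)) +
          (r - s) * (r ^ (q + 1) - s ^ (q + 1)) := by push_cast; ring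
      rw [e]
      refine (abs_add_le _ _).trans ?_
      rw [abs_mul, abs_mul, abs_of_nonneg hs]
      have h3 : s * |r ^ (q + 1) - s ^ (q + 1) - (q + 1) * s ^ q * (r - s)| ≤
          S * (K * |r - s| ^ 2) := by gcongr
      have h4 : |r - s| * |r ^ (q + 1) - s ^ (q + 1)| ≤ |r - s| * (K * |r - s|) := by gcongr
      nlinarith [mul_nonneg (pow_nonneg hS (q + 1)) (sq_nonneg |r - s|)]

theorem norm_sq_sub_eq (a b : ℂ) :
    ‖b‖ ^ 2 - ‖a‖ ^ 2 = 2 * ((starRingEnd ℂ) a * (b - a)).re + ‖b - a‖ ^ 2 := by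
  simp only [Complex.sq_norm, Complex.normSq_apply, Complex.mul_re, Complex.conj_re,
    Complex.conj_im, Complex.sub_re, Complex.sub_im]
  ring

/-- Since `‖a‖^(2q+2) = (‖a‖²)^(q+1)`, the real polynomial estimate in the variable `‖·‖²` suffices;
`norm_sq_sub_eq` expands that variable to second order. -/
theorem norm_pow_taylor_bound (q : ℕ) {M : ℝ} (hM : 0 ≤ M) :
    ∃ K : ℝ, 0 ≤ K ∧ ∀ a b : ℂ, ‖a‖ ≤ M → ‖b‖ ≤ M →
      |‖b‖ ^ (2 * q + 2) - ‖a‖ ^ (2 * q + 2) -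
        (2 * q + 2) * ‖a‖ ^ (2 * q) * ((starRingEnd ℂ) a * (b - a)).re| ≤ K * ‖b - a‖ ^ 2 := by
  obtain ⟨K, hK, h⟩ := pow_taylor_bound q (sq_nonneg M)
  refine ⟨K * (2 * M) ^ 2 + (q + 1) * (M ^ 2) ^ q, by positivity, fun a b ha hb => ?_⟩
  have h1 := (h (‖b‖ ^ 2) (‖a‖ ^ 2) (by positivity) (by gcongr) (by positivity)
    (by gcongr)).2
  have h2 : |‖b‖ ^ 2 - ‖a‖ ^ 2| ≤ 2 * M * ‖b - a‖ := by
    rw [sq_sub_sq, abs_mul, abs_of_nonneg (by positivity)]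
    have h3 := abs_norm_sub_norm_le b a
    have h4 : ‖b‖ + ‖a‖ ≤ 2 * M := by linarith
    gcongr
  have e : ‖b‖ ^ (2 * q + 2) - ‖a‖ ^ (2 * q + 2) -
      (2 * q + 2) * ‖a‖ ^ (2 * q) * ((starRingEnd ℂ) a * (b - a)).re =
      ((‖b‖ ^ 2) ^ (q + 1) - (‖a‖ ^ 2) ^ (q + 1) -
        (q + 1) * (‖a‖ ^ 2) ^ q * (‖b‖ ^ 2 - ‖a‖ ^ 2)) +
      (q + 1) * (‖a‖ ^ 2) ^ q * ‖b - a‖ ^ 2 := by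
    rw [norm_sq_sub_eq, ← pow_mul, ← pow_mul, ← pow_mul]
    ring
  rw [e]
  refine (abs_add_le _ _).trans ?_
  rw [abs_of_nonneg (a := (q + 1) * (‖a‖ ^ 2) ^ q * ‖b - a‖ ^ 2) (by positivity)]
  have h5 : (q + 1 : ℝ) * (‖a‖ ^ 2) ^ q * ‖b - a‖ ^ 2 ≤
      (q + 1) * (M ^ 2) ^ q * ‖b - a‖ ^ 2 := by gcongr
  have h6 : K * |‖b‖ ^ 2 - ‖a‖ ^ 2| ^ 2 ≤ K * (2 * M * ‖b - a‖) ^ 2 := by gcongr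
  nlinarith

theorem integrable_norm_sq (f : L2) : Integrable fun x => ‖f x‖ ^ 2 :=
  (Lp.memLp f).integrable_norm_pow (by norm_num)

theorem integrable_mul_norm_sq (f : L2) {W : ℝ → ℝ} (hW : AEStronglyMeasurable W volume) {ρ : ℝ}
    (hb : ∀ᵐ x : ℝ, |W x| ≤ ρ) : Integrable fun x => W x * ‖f x‖ ^ 2 :=
  (integrable_norm_sq f).bdd_mul hW hb

theorem integrable_norm_pow_fn (u : Hhat1) (p : ℕ) :
    Integrable fun x => ‖fn u x‖ ^ (2 * p + 2) := by
  have h : (fun x => ‖fn u x‖ ^ (2 * p + 2)) = fun x => ‖fn u x‖ ^ (2 * p) * ‖fn u x‖ ^ 2 := by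
    funext x; rw [pow_add]
  rw [h]
  refine integrable_mul_norm_sq (fn u) ((Lp.aestronglyMeasurable (fn u)).norm.pow _)
    (ρ := (2 * ‖u‖) ^ (2 * p)) ?_
  filter_upwards [ae_norm_fn_le u] with x hx
  rw [abs_of_nonneg (by positivity)]
  gcongr

theorem integral_norm_pow_fn_le (u : Hhat1) (p : ℕ) :
    ∫ x, ‖fn u x‖ ^ (2 * p + 2) ≤ (2 * ‖u‖) ^ (2 * p) * ‖fn u‖ ^ 2 := by
  rw [L2.norm_sq_eq_integral, ← integral_const_mul]
  refine integral_mono_ae (integrable_norm_pow_fn u p) ((integrable_norm_sq _).const_mul _) ?_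
  filter_upwards [ae_norm_fn_le u] with x hx
  change ‖fn u x‖ ^ (2 * p + 2) ≤ (2 * ‖u‖) ^ (2 * p) * ‖fn u x‖ ^ 2
  rw [pow_add]
  gcongr

/-- The part of the Hamiltonian of lower order. -/
def potential (p : ℕ) (σ : ℝ) (V : ℝ → ℝ) (u : Hhat1) : ℝ :=
  (∫ x, (V x / 2 - 1) * ‖fn u x‖ ^ 2) + σ / (2 * p + 2) * ∫ x, ‖fn u x‖ ^ (2 * p + 2)

theorem integral_half_sub_one_mul (f : L2) {W : ℝ → ℝ}
    (hW : Integrable fun x => W x * ‖f x‖ ^ 2) :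
    ∫ x, (W x / 2 - 1) * ‖f x‖ ^ 2 = 1 / 2 * (∫ x, W x * ‖f x‖ ^ 2) - ‖f‖ ^ 2 := by
  rw [L2.norm_sq_eq_integral, ← integral_const_mul,
    ← integral_sub (hW.const_mul _) (integrable_norm_sq _)]
  refine integral_congr_ae (Filter.Eventually.of_forall fun x => ?_)
  change (W x / 2 - 1) * ‖f x‖ ^ 2 = 1 / 2 * (W x * ‖f x‖ ^ 2) - ‖f x‖ ^ 2
  ring

theorem energy_eq_potential (p : ℕ) (σ : ℝ) {W : ℝ → ℝ} (hW : AEStronglyMeasurable W volume)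
    {ρ : ℝ} (hb : ∀ᵐ x : ℝ, |W x| ≤ ρ) (u : Hhat1) :
    energy p σ W u = 1 / 2 * ‖u‖ ^ 2 + potential p σ W u := by
  have hWi := integrable_mul_norm_sq (fn u) hW hb
  have h1 : ∫ x, (‖dx u x‖ ^ 2 + x ^ 2 * ‖fn u x‖ ^ 2 + W x * ‖fn u x‖ ^ 2) =
      ‖dx u‖ ^ 2 + ‖wt u‖ ^ 2 - ‖fn u‖ ^ 2 + ∫ x, W x * ‖fn u x‖ ^ 2 := by
    have i1 : Integrable fun x => ‖dx u x‖ ^ 2 + ‖wt u x‖ ^ 2 :=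
      (integrable_norm_sq _).add (integrable_norm_sq _)
    have i2 : Integrable fun x => ‖dx u x‖ ^ 2 + ‖wt u x‖ ^ 2 - ‖fn u x‖ ^ 2 :=
      i1.sub (integrable_norm_sq _)
    rw [L2.norm_sq_eq_integral, L2.norm_sq_eq_integral, L2.norm_sq_eq_integral,
      ← integral_add (integrable_norm_sq _) (integrable_norm_sq _),
      ← integral_sub i1 (integrable_norm_sq _), ← integral_add i2 hWi]
    refine integral_congr_ae ?_
    filter_upwards [wt_ae_eq u] with x hx
    have hbr : bracket x ^ 2 = 1 + x ^ 2 := Real.sq_sqrt (by positivity)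
    rw [hx, norm_mul, mul_pow, Complex.norm_real, Real.norm_eq_abs, sq_abs, hbr]
    ring
  rw [energy, potential, h1, integral_half_sub_one_mul _ hWi, norm_sq_Hhat1_eq]
  ring

/-- Coercivity of the Hamiltonian near zero. -/
theorem exists_coercive {p : ℕ} (hp : 1 ≤ p) {σ : ℝ} (hσ : |σ| = 1) {ρ : ℝ} (hρ : 0 < ρ) :
    ∃ C > (0 : ℝ), ∃ r > (0 : ℝ), ∀ W : ℝ → ℝ, AEStronglyMeasurable W volume →
      (∀ᵐ x : ℝ, |W x| ≤ ρ) → ∀ w : Hhat1, ‖w‖ ≤ r →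
        C⁻¹ * ‖w‖ ^ 2 ≤ energy p σ W w + ρ * ‖fn w‖ ^ 2 ∧
        energy p σ W w + ρ * ‖fn w‖ ^ 2 ≤ C * ‖w‖ ^ 2 := by
  -- `κ` serves as radius and as lower constant. With `a`, `b`, `c` the squared norms of `w`, `∂ₓw`,
  -- `⟨x⟩w`, the quadratic part is at least `b/2 + (c - a)/2 + ρa/2`, and it must dominate `(3/2)κ(b
  -- + (c - a) + 2a)`: `κ` itself plus `κ/2` for the nonlinear term. This holds for `κ ≤ 1/4` and `κ
  -- ≤ ρ/8`.
  set κ : ℝ := min (1 / 4) (ρ / 8) with hκ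
  have hκ0 : 0 < κ := lt_min (by norm_num) (by positivity)
  have hκ1 : κ ≤ 1 / 4 := min_le_left _ _
  have hκ2 : κ ≤ ρ / 8 := min_le_right _ _
  refine ⟨max κ⁻¹ (2 + 2 * ρ), lt_max_of_lt_left (by positivity), κ, hκ0,
    fun W hW hb w hw => ?_⟩
  have hWi := integrable_mul_norm_sq (fn w) hW hb
  have hWb : |∫ x, W x * ‖fn w x‖ ^ 2| ≤ ρ * ‖fn w‖ ^ 2 := by
    rw [L2.norm_sq_eq_integral, ← integral_const_mul, ← Real.norm_eq_abs]
    refine norm_integral_le_of_norm_le ((integrable_norm_sq _).const_mul _) ?_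
    filter_upwards [hb] with x hx
    rw [norm_mul, Real.norm_eq_abs, Real.norm_eq_abs, abs_of_nonneg (sq_nonneg ‖fn w x‖)]
    gcongr
  have hnl : |σ / (2 * p + 2) * ∫ x, ‖fn w x‖ ^ (2 * p + 2)| ≤ κ / 2 * ‖w‖ ^ 2 := by
    have hp' : (1 : ℝ) ≤ p := by exact_mod_cast hp
    have h0 : 0 ≤ ∫ x, ‖fn w x‖ ^ (2 * p + 2) := integral_nonneg fun x => by positivity
    rw [abs_mul, abs_div, hσ, abs_of_nonneg h0, abs_of_pos (by positivity)]
    -- Here `p ≥ 1` enters: as `2‖w‖ ≤ 1`, the power is at most its base, so the nonlinear term is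
    -- small relative to `‖w‖²` for either sign of `σ`.
    have h1 : (2 * ‖w‖) ^ (2 * p) ≤ 2 * ‖w‖ := by
      refine pow_le_of_le_one (by positivity) (by linarith) (by omega)
    have h2 : ‖fn w‖ ^ 2 ≤ ‖w‖ ^ 2 := by
      have := norm_fn_le w
      gcongr
    have h3 := integral_norm_pow_fn_le w p
    have h4 : (1 : ℝ) / (2 * p + 2) ≤ 1 / 4 :=
      one_div_le_one_div_of_le (by norm_num) (by linarith)
    calc 1 / (2 * (p : ℝ) + 2) * ∫ x, ‖fn w x‖ ^ (2 * p + 2)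
        ≤ 1 / 4 * ((2 * ‖w‖) ^ (2 * p) * ‖fn w‖ ^ 2) := by gcongr
      _ ≤ 1 / 4 * (2 * κ * ‖w‖ ^ 2) := by
          have : (2 * ‖w‖) ^ (2 * p) ≤ 2 * κ := by linarith
          gcongr
      _ = κ / 2 * ‖w‖ ^ 2 := by ring
  have hE : energy p σ W w = 1 / 2 * ‖w‖ ^ 2 + 1 / 2 * (∫ x, W x * ‖fn w x‖ ^ 2) - ‖fn w‖ ^ 2 +
      σ / (2 * p + 2) * ∫ x, ‖fn w x‖ ^ (2 * p + 2) := by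
    rw [energy_eq_potential p σ hW hb, potential,
      integral_half_sub_one_mul _ hWi]
    ring
  have hwt : ‖fn w‖ ≤ ‖wt w‖ := by
    refine Lp.norm_le_norm_of_ae_le ?_
    filter_upwards [wt_ae_eq w] with x hx
    rw [hx, norm_mul, Complex.norm_real, Real.norm_eq_abs]
    have h1 : 1 ≤ |bracket x| := by
      rw [bracket, abs_of_nonneg (Real.sqrt_nonneg _), Real.one_le_sqrt]
      nlinarith [sq_nonneg x]
    nlinarith [norm_nonneg (fn w x)]
  have hwt2 : ‖fn w‖ ^ 2 ≤ ‖wt w‖ ^ 2 := by gcongr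
  have hN := norm_sq_Hhat1_eq w
  have ha := sq_nonneg ‖fn w‖
  have hbb := sq_nonneg ‖dx w‖
  obtain ⟨hW1, hW2⟩ := abs_le.1 hWb
  obtain ⟨hn1, hn2⟩ := abs_le.1 hnl
  set a := ‖fn w‖ ^ 2
  set b := ‖dx w‖ ^ 2
  set c := ‖wt w‖ ^ 2
  rw [hE]
  constructor
  · have h1 : (max κ⁻¹ (2 + 2 * ρ))⁻¹ ≤ κ := by
      rw [inv_le_comm₀ (lt_max_of_lt_left (by positivity)) hκ0]
      exact le_max_left _ _
    have h2 : (max κ⁻¹ (2 + 2 * ρ))⁻¹ * ‖w‖ ^ 2 ≤ κ * ‖w‖ ^ 2 := by gcongr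
    have h3 : κ * b ≤ 1 / 4 * b := by gcongr
    have h4 : κ * (c - a) ≤ 1 / 4 * (c - a) := by
      have : 0 ≤ c - a := by linarith
      gcongr
    have h5 : κ * a ≤ ρ / 8 * a := by gcongr
    rw [hN] at h2 hn1 ⊢
    rw [hN] at hn2
    nlinarith
  · have h1 : (2 + 2 * ρ) * ‖w‖ ^ 2 ≤ max κ⁻¹ (2 + 2 * ρ) * ‖w‖ ^ 2 := by
      gcongr
      exact le_max_right _ _
    have h2 : κ / 2 * ‖w‖ ^ 2 ≤ 1 / 8 * ‖w‖ ^ 2 := by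
      have : κ / 2 ≤ 1 / 8 := by linarith
      gcongr
    have h3 : ρ * a ≤ ρ * ‖w‖ ^ 2 := by
      rw [hN]
      have : a ≤ a + b + c := by linarith [sq_nonneg ‖wt w‖]
      gcongr
    have h4 := sq_nonneg ‖w‖
    nlinarith

/-- Gauge invariance: pointwise the nonlinearity is a real multiple of `u`. This is what conserves
mass. -/
theorem im_inner_nonlin (p : ℕ) (σ : ℝ) {V : ℝ → ℝ} {V' : Hhat1}
    (hV : ∀ᵐ x : ℝ, fn V' x = (V x : ℂ)) (u : Hhat1) :
    (inner ℂ (fn u) (fn (nonlin p σ V' u))).im = 0 := by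
  have h : inner ℂ (fn u) (fn (nonlin p σ V' u)) =
      ∫ x, (((V x - 2 + σ * ‖fn u x‖ ^ (2 * p)) * ‖fn u x‖ ^ 2 : ℝ) : ℂ) := by
    rw [MeasureTheory.L2.inner_def]
    refine integral_congr_ae ?_
    filter_upwards [hV, fn_nonlin p σ V' u] with x h1 h2
    rw [h2, h1, RCLike.inner_apply, mul_assoc, Complex.mul_conj']
    push_cast
    ring
  rw [h, integral_complex_ofReal, Complex.ofReal_im]

/-- `nonlin` is the gradient of `potential`. -/
theorem potential_taylor_bound (p : ℕ) (σ : ℝ) {V : ℝ → ℝ} {V' : Hhat1}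
    (hV : ∀ᵐ x : ℝ, fn V' x = (V x : ℂ)) (hVm : AEStronglyMeasurable V volume) (M : ℝ) :
    ∃ K : ℝ, 0 ≤ K ∧ ∀ a b : Hhat1, ‖a‖ ≤ M → ‖b‖ ≤ M →
      |potential p σ V b - potential p σ V a -
        (inner ℂ (fn (nonlin p σ V' a)) (fn (b - a))).re| ≤ K * ‖fn (b - a)‖ ^ 2 := by
  obtain ⟨K, hK, hT⟩ := norm_pow_taylor_bound p (M := 2 * |M|) (by positivity)
  have hVb : ∀ᵐ x : ℝ, |V x / 2 - 1| ≤ ‖V'‖ + 1 := by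
    filter_upwards [hV, ae_norm_fn_le V'] with x h1 h2
    rw [h1, Complex.norm_real, Real.norm_eq_abs] at h2
    obtain ⟨h3, h4⟩ := abs_le.1 h2
    exact abs_le.2 ⟨by linarith, by linarith⟩
  have hVm' : AEStronglyMeasurable (fun x => V x / 2 - 1) volume := by fun_prop
  refine ⟨(‖V'‖ + 1) + |σ / (2 * p + 2)| * K, by positivity, fun a b ha hb => ?_⟩
  have iq : ∀ u : Hhat1, Integrable fun x => (V x / 2 - 1) * ‖fn u x‖ ^ 2 := fun u =>
    integrable_mul_norm_sq _ hVm' hVb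
  have ip : ∀ u : Hhat1, Integrable fun x => σ / (2 * p + 2) * ‖fn u x‖ ^ (2 * p + 2) :=
    fun u => (integrable_norm_pow_fn u p).const_mul _
  have hpot : ∀ u : Hhat1, potential p σ V u =
      ∫ x, ((V x / 2 - 1) * ‖fn u x‖ ^ 2 + σ / (2 * p + 2) * ‖fn u x‖ ^ (2 * p + 2)) :=
    fun u => by rw [potential, ← integral_const_mul, ← integral_add (iq u) (ip u)]
  have ii : Integrable fun x => inner ℂ (fn (nonlin p σ V' a) x) (fn (b - a) x) :=
    MeasureTheory.L2.integrable_inner _ _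
  have hin : (inner ℂ (fn (nonlin p σ V' a)) (fn (b - a))).re =
      ∫ x, (inner ℂ (fn (nonlin p σ V' a) x) (fn (b - a) x) : ℂ).re := by
    rw [MeasureTheory.L2.inner_def]
    exact (integral_re ii).symm
  have hintg : ∀ u : Hhat1, Integrable fun x =>
      (V x / 2 - 1) * ‖fn u x‖ ^ 2 + σ / (2 * p + 2) * ‖fn u x‖ ^ (2 * p + 2) :=
    fun u => (iq u).add (ip u)
  have hdiff := (hintg b).sub (hintg a)
  simp only [Pi.sub_def] at hdiff
  have hlin : Integrable fun x => (inner ℂ (fn (nonlin p σ V' a) x) (fn (b - a) x) : ℂ).re := ii.re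
  rw [hpot, hpot, hin, ← integral_sub (hintg b) (hintg a), ← integral_sub hdiff hlin, ← Real.norm_eq_abs,
    L2.norm_sq_eq_integral, ← integral_const_mul]
  refine norm_integral_le_of_norm_le ((integrable_norm_sq _).const_mul _) ?_
  filter_upwards [hV, hVb, fn_nonlin p σ V' a, fn_sub_ae b a, ae_norm_fn_le a, ae_norm_fn_le b]
    with x h1 h2 h3 h4 h5 h6
  have hM : M ≤ |M| := le_abs_self M
  have ht := hT (fn a x) (fn b x) (by linarith) (by linarith)
  have hre : (inner ℂ (fn (nonlin p σ V' a) x) (fn (b - a) x) : ℂ).re =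
      (V x - 2 + σ * ‖fn a x‖ ^ (2 * p)) * ((starRingEnd ℂ) (fn a x) * (fn b x - fn a x)).re := by
    rw [h3, h4, h1, RCLike.inner_apply]
    have : (fn b x - fn a x) * (starRingEnd ℂ) (((V x : ℂ) - 2 +
        σ * ((‖fn a x‖ ^ (2 * p) : ℝ) : ℂ)) * fn a x) =
        ((V x - 2 + σ * ‖fn a x‖ ^ (2 * p) : ℝ) : ℂ) *
          ((starRingEnd ℂ) (fn a x) * (fn b x - fn a x)) := by
      have h7 : ((V x : ℂ) - 2 + σ * ((‖fn a x‖ ^ (2 * p) : ℝ) : ℂ)) =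
          ((V x - 2 + σ * ‖fn a x‖ ^ (2 * p) : ℝ) : ℂ) := by push_cast; rfl
      rw [h7, map_mul, Complex.conj_ofReal]
      ring
    rw [this, Complex.re_ofReal_mul]
  rw [hre, h4]
  set z := ((starRingEnd ℂ) (fn a x) * (fn b x - fn a x)).re with hz
  have hsq := norm_sq_sub_eq (fn a x) (fn b x)
  rw [← hz] at hsq
  have hp2 : (2 * (p : ℝ) + 2) ≠ 0 := by positivity
  -- The terms linear in `b - a` cancel exactly, leaving the second-order part of the quadratic term
  -- and the Taylor remainder of the power.
  have e : (V x / 2 - 1) * ‖fn b x‖ ^ 2 + σ / (2 * p + 2) * ‖fn b x‖ ^ (2 * p + 2) -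
      ((V x / 2 - 1) * ‖fn a x‖ ^ 2 + σ / (2 * p + 2) * ‖fn a x‖ ^ (2 * p + 2)) -
      (V x - 2 + σ * ‖fn a x‖ ^ (2 * p)) * z =
      (V x / 2 - 1) * ‖fn b x - fn a x‖ ^ 2 + σ / (2 * p + 2) *
        (‖fn b x‖ ^ (2 * p + 2) - ‖fn a x‖ ^ (2 * p + 2) -
          (2 * p + 2) * ‖fn a x‖ ^ (2 * p) * z) := by
    have h8 : σ / (2 * p + 2) * ((2 * p + 2) * ‖fn a x‖ ^ (2 * p) * z) =
        σ * ‖fn a x‖ ^ (2 * p) * z := by field_simp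
    rw [mul_sub (σ / (2 * p + 2)), h8]
    linear_combination (V x / 2 - 1) * hsq
  rw [e]
  refine (norm_add_le _ _).trans ?_
  rw [norm_mul, norm_mul, Real.norm_eq_abs, Real.norm_eq_abs, Real.norm_eq_abs,
    Real.norm_eq_abs, abs_of_nonneg (sq_nonneg ‖fn b x - fn a x‖),
    add_mul (‖V'‖ + 1)]
  refine add_le_add (mul_le_mul_of_nonneg_right h2 (sq_nonneg _)) ?_
  exact (mul_le_mul_of_nonneg_left ht (abs_nonneg _)).trans (le_of_eq (by ring))

end HarmonicNLS

end

/-! ### Choice of the constants and conclusion. -/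

theorem theorem5p3 (p : ℕ) (hp : 1 ≤ p) (σ : ℝ) (hσ : σ = 1 ∨ σ = -1)
    (ρ : ℝ) (hρ : 0 < ρ) :
    ∃ ε > (0 : ℝ), ∃ C > (0 : ℝ),
      -- `ε` and `C` are constants for which the Hamiltonian is coercive
      (∀ W : ℝ → ℝ, AEStronglyMeasurable W volume → (∀ᵐ x : ℝ, |W x| ≤ ρ) →
        ∀ w : HarmonicNLS.Hhat1, ‖w‖ ≤ C * ε →
          C⁻¹ * ‖w‖ ^ 2 ≤ HarmonicNLS.energy p σ W w + ρ * ‖HarmonicNLS.fn w‖ ^ 2 ∧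
          HarmonicNLS.energy p σ W w + ρ * ‖HarmonicNLS.fn w‖ ^ 2 ≤ C * ‖w‖ ^ 2) ∧
      -- global well-posedness, for every real-valued `V ∈ Ĥ¹` with norm at most `ρ`
      (∀ (V : ℝ → ℝ) (V' : HarmonicNLS.Hhat1), (∀ᵐ x : ℝ, HarmonicNLS.fn V' x = (V x : ℂ)) → ‖V'‖ ≤ ρ →
        ∀ u₀ : HarmonicNLS.Hhat1, ‖u₀‖ ≤ ε →
          ∃ u : ℝ →ᵇ HarmonicNLS.Hhat1,
            HarmonicNLS.IsGlobalSolution p σ V u₀ u ∧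
            (∀ t : ℝ, ‖u t‖ ≤ C * ‖u₀‖) ∧
            ∀ v : ℝ →ᵇ HarmonicNLS.Hhat1, HarmonicNLS.IsGlobalSolution p σ V u₀ v → v = u) := by
  open HarmonicNLS in
  have hσ' : |σ| = 1 := by rcases hσ with rfl | rfl <;> simp
  obtain ⟨C₁, hC₁, r₁, hr₁, h₁⟩ := exists_coercive hp hσ' hρ
  -- In the evolution problem `‖V‖_{Ĥ¹} ≤ ρ` only gives `|V| ≤ 2ρ`, so the functional used there is
  -- shifted by `2ρ` instead of `ρ`.
  obtain ⟨C₂, hC₂, r₂, hr₂, h₂⟩ := exists_coercive hp hσ' (ρ := 2 * ρ) (by positivity)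
  set C := max 1 (max C₁ C₂) with hCdef
  set R := min r₁ r₂ with hRdef
  have hC1 : 1 ≤ C := le_max_left _ _
  have hCC₁ : C₁ ≤ C := (le_max_left _ _).trans (le_max_right _ _)
  have hCC₂ : C₂ ≤ C := (le_max_right _ _).trans (le_max_right _ _)
  have hC : 0 < C := by linarith
  have hR : 0 < R := lt_min hr₁ hr₂
  have hmono : ∀ {D E n : ℝ}, 0 < D → D ≤ C → 0 ≤ n → D⁻¹ * n ≤ E ∧ E ≤ D * n →
      C⁻¹ * n ≤ E ∧ E ≤ C * n := by
    intro D E n hD hDC hn h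
    have h3 : C⁻¹ ≤ D⁻¹ := inv_anti₀ hD hDC
    exact ⟨(mul_le_mul_of_nonneg_right h3 hn).trans h.1,
      h.2.trans (mul_le_mul_of_nonneg_right hDC hn)⟩
  -- The factor `1/2` leaves `C‖u₀‖ ≤ R/2` strictly below `R`, as the continuity argument requires.
  refine ⟨R / (2 * C), by positivity, C, hC, ?_, ?_⟩
  · intro W hW hb w hw
    have hCe : C * (R / (2 * C)) = R / 2 := by field_simp
    rw [hCe] at hw
    exact hmono hC₁ hCC₁ (sq_nonneg _)
      (h₁ W hW hb w (by linarith [min_le_left r₁ r₂]))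
  · intro V V' hV hV' u₀ hu₀
    have hVm : AEStronglyMeasurable V volume := by
      refine (Complex.continuous_re.comp_aestronglyMeasurable
        (Lp.aestronglyMeasurable (fn V'))).congr ?_
      filter_upwards [hV] with x hx
      simp [hx]
    have hVb : ∀ᵐ x : ℝ, |V x| ≤ 2 * ρ := by
      filter_upwards [hV, ae_norm_fn_le V'] with x h3 h4
      rw [h3, Complex.norm_real, Real.norm_eq_abs] at h4
      linarith
    have hCu₀ : C * ‖u₀‖ ≤ R / 2 := by
      calc C * ‖u₀‖ ≤ C * (R / (2 * C)) := by gcongr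
        _ = R / 2 := by field_simp
    have hu₀R : ‖u₀‖ ≤ R := by nlinarith [norm_nonneg u₀]
    obtain ⟨K, hK, hG⟩ := nonlin_lipschitz_norm p σ V' hR.le
    obtain ⟨u, huc, hu0, hub, hud⟩ := exists_global_of_coercive fn_injective
      (P := potential p σ V) (κ := 2 * ρ) hR hC hK hG (im_inner_nonlin p σ hV)
      (potential_taylor_bound p σ hV hVm)
      (fun w hw => by
        rw [← energy_eq_potential p σ hVm hVb]
        exact hmono hC₂ hCC₂ (sq_nonneg _) (h₂ V hVm hVb w (hw.trans (min_le_right _ _))))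
      u₀ hu₀R (by linarith)
    set ub : ℝ →ᵇ Hhat1 := BoundedContinuousFunction.ofNormedAddCommGroup u huc (C * ‖u₀‖) hub
    refine ⟨ub, (isGlobalSolution_iff p σ hV u₀ ub).2 ⟨hu0, hud⟩, hub, fun v hv => ?_⟩
    obtain ⟨hv0, hvd⟩ := (isGlobalSolution_iff p σ hV u₀ v).1 hv
    -- The competitor `v` is not assumed small; its boundedness in time alone supplies a Lipschitz
    -- constant.
    obtain ⟨K', -, hG'⟩ := nonlin_lipschitz_fn p σ V' (M := max ‖v‖ ‖ub‖)
      ((norm_nonneg _).trans (le_max_left _ _))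
    refine DFunLike.coe_injective (eq_of_hasDerivAt_gram fn_injective hG' v.continuous
      ub.continuous (fun t => (v.norm_coe_le_norm t).trans (le_max_left _ _))
      (fun t => (ub.norm_coe_le_norm t).trans (le_max_right _ _)) hvd hud ?_)
    exact hv0.trans hu0.symm
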